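/- Let $n\ge 1$ and $\lambda>0$. For Schwartz functions $f,g$ on $\mathbb R^n$ define the bilinear maximal Bochner–Riesz operator $$T_*^\lambda(f,g)(x)=\sup_{t>0}\Big|\int_{\mathbb R^n}\int_{\mathbb R^n}\big(1-(|t\xi|^2+|t\eta|^2)\big)_+^{\lambda}\,\widehat f(\xi)\,\widehat g(\eta)\,e^{2\pi i x\cdot(\xi+\eta)}\,d\xi\,d\eta\Big|,\qquad \widehat f(\xi)=\int_{\mathbb R^n}f(y)e^{-2\pi i y\cdot\xi}\,dy .$$ Let $0<p_1,p_2,p\le\infty$, and suppose that $T_*^\lambda$ is bounded from $L^{p_1}(\mathbb R^n)\times L^{p_2}(\mathbb R^n)$ to weak $L^p(\mathbb R^n)$, that is, there is a finite constant $C$ such that $$\|T_*^\lambda(f,g)\|_{L^{p,\infty}}\le C\,\|f\|_{L^{p_1}}\|g\|_{L^{p_2}}$$ for all Schwartz functions $f,g$ on $\mathbb R^n$, where $\|F\|_{L^{p,\infty}}=\sup_{a>0}a\,|\{x:|F(x)|>a\}|^{1/p}$ for $p<\infty$ and $L^{\infty,\infty}=L^\infty$. Then $$\lambda\ \ge\ \frac{2n-1}{2p}-\frac{2n-1}{2},$$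 where $1/p=0$ if $p=\infty$. -/

import Mathlib

open MeasureTheory FourierTransform
open scoped ENNReal NNReal SchwartzMap

noncomputable section

/-- The Bochner-Riesz multiplier `m(ξ, η) = (1 - (|ξ|² + |η|²))₊ ^ lam` on `ℝⁿ × ℝⁿ`
(for `lam > 0` it vanishes outside the unit ball). -/
def brMultiplier {n : ℕ} (lam : ℝ) (ξ η : EuclideanSpace ℝ (Fin n)) : ℝ :=
  (max (1 - (‖ξ‖ ^ 2 + ‖η‖ ^ 2)) 0) ^ lam

/-- The bilinear Bochner-Riesz means
`A_t(f, g)(x) = ∫ ∫ m(tξ, tη) 𝓕f(ξ) 𝓕g(η) exp(2πi x·(ξ + η)) dξ dη`. -/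
def bilinearBR {n : ℕ} (lam t : ℝ) (f g : 𝓢(EuclideanSpace ℝ (Fin n), ℂ))
    (x : EuclideanSpace ℝ (Fin n)) : ℂ :=
  ∫ ξ : EuclideanSpace ℝ (Fin n), ∫ η : EuclideanSpace ℝ (Fin n),
    (brMultiplier lam (t • ξ) (t • η) : ℂ) *
      𝓕 (f : EuclideanSpace ℝ (Fin n) → ℂ) ξ * 𝓕 (g : EuclideanSpace ℝ (Fin n) → ℂ) η *
      Complex.exp (2 * Real.pi * Complex.I * (inner ℝ x (ξ + η) : ℝ))

/-- The bilinear maximal Bochner-Riesz operator `T_*(f, g)(x) = sup_{t > 0} |A_t(f, g)(x)|`. -/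
def maximalBR {n : ℕ} (lam : ℝ) (f g : 𝓢(EuclideanSpace ℝ (Fin n), ℂ))
    (x : EuclideanSpace ℝ (Fin n)) : ℝ≥0∞ :=
  ⨆ (t : ℝ) (_ : 0 < t), ‖bilinearBR lam t f g x‖ₑ

/-- The weak `L^p` quasinorm `sup_{a > 0} a · μ{F > a}^{1/p}` of a nonnegative function,
with the usual convention that weak `L^∞` is `L^∞`. -/
def weakLpNorm {X : Type*} [MeasurableSpace X] (F : X → ℝ≥0∞) (p : ℝ≥0∞) (μ : Measure X) :
    ℝ≥0∞ :=
  if p = ∞ then essSup F μ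
  else ⨆ a : ℝ≥0, (a : ℝ≥0∞) * μ {x | (a : ℝ≥0∞) < F x} ^ (1 / p.toReal)

/-- `T_*` is bounded from `L^{p₁}(ℝⁿ) × L^{p₂}(ℝⁿ)` to weak `L^p(ℝⁿ)`: the a priori inequality
holds, with a uniform constant, for all Schwartz functions. -/
def MaximalBRWeakBounded (n : ℕ) (lam : ℝ) (p₁ p₂ p : ℝ≥0∞) : Prop :=
  ∃ C : ℝ≥0, ∀ f g : 𝓢(EuclideanSpace ℝ (Fin n), ℂ),
    weakLpNorm (maximalBR lam f g) p volume ≤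
      C * eLpNorm f p₁ volume * eLpNorm g p₂ volume

end

/-! The operator is tested on `f = g` with Fourier transform the Gaussian `exp (-(N (ξ₀ - 1)² + ∑
ξᵢ²))`, `N = M²`. In space `|f|` is a Gaussian of height about `M⁻¹`, width `M` along the first axis
and width `1` across it, so its `L^p` norm is a constant times `M ^ (1/p - 1)` (`eLpNorm_thinTest`).
On a ball of radius about `M²` around `M² e₀` the maximal function is at least `c M ^ (-(2 lam + 2 m
+ 3))`, where `n = m + 1` (`exists_maximalBR_thinTest_ge`). Dilation invariance forces `1/p = 1/p₁ +
1/p₂` when `p < ∞`; comparing powers of `M` as `M → ∞` then gives the claim.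

The lower bound avoids asymptotics of Bessel kernels. With `r = t⁻²`, the mean times `r ^ lam` is an
integral of `(r - |ξ|² - |η|²)₊ ^ lam`, whose Laplace transform in `r` is `Γ(lam + 1) z ^ (-lam -
1)` times a product of two complex heat evolutions (`integral_brProfile`). For Gaussian data these
are explicit (`integral_thinGaussian`). On `Re z = 1` with `Im z` of order `M²` they have a wave
packet at the point considered.

Bounding one value of the transform by the supremum would lose a factor `M`. Instead the transform
is averaged over a window of length of order `M` in `Im z`, with a modulation that concentrates `r`
within about `1/M` of the energy `|ξ|² + |η|²` of the packet (`exists_norm_window_laplace_le`).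
After the modulation cancels the oscillation, the averaged transform converges, up to an explicit
power of `M` and a unimodular factor, to a nonzero limit (`integral_windowSymbol_ne_zero`). -/

/-! ### Gaussian-type Schwartz functions -/

section ExpNeg

variable {E : Type*} [NormedAddCommGroup E] [NormedSpace ℝ E]

/-- If `q` has temperate growth and grows at least like the norm, then all derivatives of
`exp (-q)` are rapidly decreasing. -/
theorem exists_pow_mul_norm_iteratedFDeriv_exp_neg_le {q : E → ℝ} (hq : q.HasTemperateGrowth)
    {K : ℝ} (hK : ∀ x, ‖x‖ ≤ q x + K) (k n : ℕ) :
    ∃ C : ℝ, ∀ x, ‖x‖ ^ k * ‖iteratedFDeriv ℝ n (fun x ↦ Real.exp (-q x)) x‖ ≤ C := by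
  obtain ⟨l, C₁, hC₁, h₁⟩ := hq.neg.norm_iteratedFDeriv_le_uniform n
  refine ⟨n.factorial * (1 + C₁) ^ n * Real.exp (K + 1) * (k + l * n).factorial, fun x ↦ ?_⟩
  have hu : 1 ≤ 1 + ‖x‖ := by simp
  -- The Faà di Bruno estimate needs one base whose `i`-th power dominates the `i`-th derivative;
  -- using `1 + C₁` keeps that base at least `1`.
  have hD : ∀ i, 1 ≤ i → i ≤ n →
      ‖iteratedFDeriv ℝ i (-q) x‖ ≤ ((1 + C₁) * (1 + ‖x‖) ^ l) ^ i := by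
    intro i hi hin
    calc _ ≤ C₁ * (1 + ‖x‖) ^ l := h₁ i hin x
      _ ≤ (1 + C₁) * (1 + ‖x‖) ^ l := by gcongr; simp
      _ ≤ _ := le_self_pow₀ (one_le_mul_of_one_le_of_one_le (by linarith) (one_le_pow₀ hu))
        (by omega)
  have hC : ∀ i, i ≤ n → ‖iteratedFDeriv ℝ i Real.exp ((-q) x)‖ ≤ Real.exp (-q x) := by
    intro i _
    rw [norm_iteratedFDeriv_eq_norm_iteratedDeriv]
    simp [iteratedDeriv_eq_iterate, Real.iter_deriv_exp]
  have h := norm_iteratedFDeriv_comp_le (g := Real.exp) (f := -q) (N := ((⊤ : ℕ∞) : WithTop ℕ∞))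
    Real.contDiff_exp hq.neg.1 (mod_cast le_top) x hC hD
  have hexp : Real.exp (-q x) * (1 + ‖x‖) ^ (k + l * n) ≤
      Real.exp (K + 1) * (k + l * n).factorial := by
    have h2 := Real.pow_div_factorial_le_exp (1 + ‖x‖) (by positivity) (k + l * n)
    rw [div_le_iff₀ (by positivity)] at h2
    calc Real.exp (-q x) * (1 + ‖x‖) ^ (k + l * n)
        ≤ Real.exp (-q x) * (Real.exp (1 + ‖x‖) * (k + l * n).factorial) := by gcongr
      _ = Real.exp (-q x + (1 + ‖x‖)) * (k + l * n).factorial := by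
        rw [Real.exp_add (-q x)]; ring
      _ ≤ _ := by
        refine mul_le_mul_of_nonneg_right (Real.exp_le_exp.2 ?_) (by positivity)
        linarith [hK x]
  calc ‖x‖ ^ k * ‖iteratedFDeriv ℝ n (fun x ↦ Real.exp (-q x)) x‖
      ≤ (1 + ‖x‖) ^ k * (n.factorial * Real.exp (-q x) * ((1 + C₁) * (1 + ‖x‖) ^ l) ^ n) := by
        gcongr
        · simp
        · exact h
    _ = n.factorial * (1 + C₁) ^ n * (Real.exp (-q x) * (1 + ‖x‖) ^ (k + l * n)) := by
        rw [mul_pow, pow_add, pow_mul]; ring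
    _ ≤ n.factorial * (1 + C₁) ^ n * (Real.exp (K + 1) * (k + l * n).factorial) := by gcongr
    _ = _ := by ring

/-- The Schwartz function `exp (-q)`, where `q` has temperate growth and `‖x‖ ≤ q x + K`. -/
noncomputable def expNegSchwartz (q : E → ℝ) (hq : q.HasTemperateGrowth)
    (K : ℝ) (hK : ∀ x, ‖x‖ ≤ q x + K) : 𝓢(E, ℝ) where
  toFun x := Real.exp (-q x)
  smooth' := Real.contDiff_exp.comp hq.neg.1
  decay' := exists_pow_mul_norm_iteratedFDeriv_exp_neg_le hq hK

end ExpNeg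

/-- The quadratic form `N (ξ₀ - 1)² + ∑_{i ≥ 1} ξᵢ²`. -/
noncomputable def thinForm {m : ℕ} (N : ℝ) (ξ : EuclideanSpace ℝ (Fin (m + 1))) : ℝ :=
  N * (ξ 0 - 1) ^ 2 + ∑ i : Fin m, ξ i.succ ^ 2

theorem thinForm_hasTemperateGrowth {m : ℕ} (N : ℝ) :
    (thinForm (m := m) N).HasTemperateGrowth := by
  have h (i : Fin (m + 1)) : Function.HasTemperateGrowth
      (fun ξ : EuclideanSpace ℝ (Fin (m + 1)) ↦ ξ i) :=
    (EuclideanSpace.proj (𝕜 := ℝ) i).hasTemperateGrowth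
  unfold thinForm
  refine .add (.mul (.const N) (.pow (.sub (h 0) (.const 1)) 2)) (.sum fun i _ ↦ ?_)
  exact (h i.succ).pow 2

/-- From `ξ₀² ≤ 2 (ξ₀ - 1)² + 2`, that is `(ξ₀ - 2)² ≥ 0`, one gets `‖ξ‖² ≤ 2 T + 2 ≤ (T + 2)²` with
`T` the form. -/
theorem norm_le_thinForm_add {m : ℕ} {N : ℝ} (hN : 1 ≤ N)
    (ξ : EuclideanSpace ℝ (Fin (m + 1))) : ‖ξ‖ ≤ thinForm N ξ + 2 := by
  have h1 : ‖ξ‖ ^ 2 = ξ 0 ^ 2 + ∑ i : Fin m, ξ i.succ ^ 2 := by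
    rw [EuclideanSpace.real_norm_sq_eq, Fin.sum_univ_succ]
  have h2 : 0 ≤ ∑ i : Fin m, ξ i.succ ^ 2 := Finset.sum_nonneg fun i _ ↦ sq_nonneg _
  unfold thinForm
  set S := ∑ i : Fin m, ξ i.succ ^ 2
  have h3 : (ξ 0 - 1) ^ 2 ≤ N * (ξ 0 - 1) ^ 2 := le_mul_of_one_le_left (sq_nonneg _) hN
  refine (sq_le_sq₀ (norm_nonneg _) (by positivity)).1 ?_
  have h4 : ‖ξ‖ ^ 2 ≤ 2 * (N * (ξ 0 - 1) ^ 2 + S) + 2 := by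
    nlinarith [sq_nonneg (ξ 0 - 2)]
  nlinarith [sq_nonneg (N * (ξ 0 - 1) ^ 2 + S), sq_nonneg (ξ 0 - 1)]

/-- The Gaussian `exp (-(N (ξ₀ - 1)² + ∑_{i ≥ 1} ξᵢ²))`, as a Schwartz function. -/
noncomputable def thinGaussian (m : ℕ) {N : ℝ} (hN : 1 ≤ N) :
    𝓢(EuclideanSpace ℝ (Fin (m + 1)), ℂ) :=
  SchwartzMap.postcompCLM Complex.ofRealCLM
    (expNegSchwartz (thinForm N) (thinForm_hasTemperateGrowth N) 2 (norm_le_thinForm_add hN))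

theorem thinGaussian_apply {m : ℕ} {N : ℝ} (hN : 1 ≤ N) (ξ : EuclideanSpace ℝ (Fin (m + 1))) :
    thinGaussian m hN ξ = Complex.exp (-(N * (ξ 0 - 1) ^ 2 + ∑ i : Fin m, (ξ i.succ : ℂ) ^ 2)) := by
  have : thinGaussian m hN ξ = ((Real.exp (-thinForm N ξ) : ℝ) : ℂ) := rfl
  rw [this, thinForm]
  push_cast
  rfl

/-- The Fourier side evolution of `thinGaussian` under the complex heat flow, in closed form. -/
theorem integral_thinGaussian {m : ℕ} {N : ℝ} (hN : 1 ≤ N) {z : ℂ} (hz : 0 ≤ z.re)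
    (x : EuclideanSpace ℝ (Fin (m + 1))) :
    ∫ ξ, Complex.exp (-z * (‖ξ‖ ^ 2 : ℝ)) * thinGaussian m hN ξ *
        Complex.exp (2 * Real.pi * Complex.I * (inner ℝ x ξ : ℝ)) =
      (Real.pi / (N + z)) ^ (1 / 2 : ℂ) * ((Real.pi / (1 + z)) ^ (1 / 2 : ℂ)) ^ m *
        Complex.exp ((N + Real.pi * Complex.I * x 0) ^ 2 / (N + z) - N -
          Real.pi ^ 2 * (∑ i : Fin m, (x i.succ : ℂ) ^ 2) / (1 + z)) := by
  let b : Fin (m + 1) → ℂ := Fin.cons (N + z) fun _ ↦ 1 + z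
  let c : Fin (m + 1) → ℂ := Fin.cons (2 * (N + Real.pi * Complex.I * x 0))
    fun i ↦ 2 * Real.pi * Complex.I * x i.succ
  have hb : ∀ i, 0 < (b i).re := by
    intro i
    refine Fin.cases ?_ (fun i ↦ ?_) i
    · simp [b]; linarith
    · simp [b]; linarith
  have hNz : (N : ℂ) + z ≠ 0 := fun h ↦ by simpa [b, h] using hb 0
  have hz1 : 1 + z ≠ 0 := fun h ↦ by
    have := congrArg Complex.re h
    simp at this; linarith
  have key := GaussianFourier.integral_cexp_neg_sum_mul_add hb c
  rw [← (PiLp.volume_preserving_toLp (Fin (m + 1))).integral_comp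
    (MeasurableEquiv.toLp 2 _).measurableEmbedding]
  have hint : ∀ v : Fin (m + 1) → ℝ,
      Complex.exp (-z * (‖WithLp.toLp 2 v‖ ^ 2 : ℝ)) * thinGaussian m hN (WithLp.toLp 2 v) *
        Complex.exp (2 * Real.pi * Complex.I * (inner ℝ x (WithLp.toLp 2 v) : ℝ)) =
      Complex.exp (-N) *
        Complex.exp (-∑ i, b i * (v i : ℂ) ^ 2 + ∑ i, c i * v i) := by
    intro v
    rw [thinGaussian_apply, EuclideanSpace.real_norm_sq_eq, PiLp.inner_apply]
    simp only [Fin.sum_univ_succ, b, c, Fin.cons_zero, Fin.cons_succ, ← Complex.exp_add]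
    congr 1
    simp only [RCLike.inner_apply, conj_trivial]
    push_cast
    simp only [mul_assoc, ← Finset.mul_sum]
    have : ∑ i : Fin m, (v i.succ : ℂ) * (x i.succ : ℂ) = ∑ i : Fin m, (x i.succ : ℂ) * v i.succ :=
      Finset.sum_congr rfl fun _ _ ↦ mul_comm _ _
    rw [this]
    ring
  simp_rw [hint]
  rw [integral_const_mul, key, Fin.prod_univ_succ, Finset.prod_mul_distrib, ← Complex.exp_sum]
  simp only [b, c, Fin.cons_zero, Fin.cons_succ, Finset.prod_const, Finset.card_univ,
    Fintype.card_fin]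
  have e1 : ∑ i : Fin m, (2 * Real.pi * Complex.I * (x i.succ : ℂ)) ^ 2 / (4 * (1 + z)) =
      -(Real.pi ^ 2 * (∑ i : Fin m, (x i.succ : ℂ) ^ 2) / (1 + z)) := by
    rw [Finset.mul_sum, Finset.sum_div, ← Finset.sum_neg_distrib]
    refine Finset.sum_congr rfl fun i _ ↦ ?_
    field_simp
    rw [Complex.I_sq]
    ring
  have e2 : (2 * (N + Real.pi * Complex.I * (x 0 : ℂ))) ^ 2 / (4 * (N + z)) =
      (N + Real.pi * Complex.I * x 0) ^ 2 / (N + z) := by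
    field_simp
    ring
  rw [e1, e2, Complex.exp_sub, Complex.exp_sub, Complex.exp_neg, Complex.exp_neg]
  ring

/-! ### The Fourier inverse of the thin Gaussian and its `L^p` norms -/

/-- The Schwartz function whose Fourier transform is `thinGaussian`. -/
noncomputable def thinTest (m : ℕ) {N : ℝ} (hN : 1 ≤ N) :
    𝓢(EuclideanSpace ℝ (Fin (m + 1)), ℂ) :=
  𝓕⁻ (thinGaussian m hN)

theorem fourier_thinTest {m : ℕ} {N : ℝ} (hN : 1 ≤ N) :
    𝓕 (thinTest m hN : EuclideanSpace ℝ (Fin (m + 1)) → ℂ) = thinGaussian m hN := by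
  rw [← SchwartzMap.fourier_coe, thinTest, fourier_fourierInv_eq]

/-- This is the heat evolution formula at time `z = 0`; the modulus removes the carrier wave `exp
(2πi y₀)`. -/
theorem norm_thinTest {m : ℕ} {N : ℝ} (hN : 1 ≤ N) (y : EuclideanSpace ℝ (Fin (m + 1))) :
    ‖thinTest m hN y‖ = (Real.pi / N) ^ (1 / 2 : ℝ) * (Real.pi ^ (1 / 2 : ℝ)) ^ m *
      Real.exp (-Real.pi ^ 2 * y 0 ^ 2 / N - Real.pi ^ 2 * ∑ i : Fin m, y i.succ ^ 2) := by
  have hN0 : (0 : ℝ) < N := by linarith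
  have h : thinTest m hN y = ∫ ξ, Complex.exp (-(0 : ℂ) * (‖ξ‖ ^ 2 : ℝ)) * thinGaussian m hN ξ *
        Complex.exp (2 * Real.pi * Complex.I * (inner ℝ y ξ : ℝ)) := by
    rw [thinTest, SchwartzMap.fourierInv_coe, Real.fourierInv_eq']
    refine integral_congr_ae (ae_of_all _ fun ξ ↦ ?_)
    simp only [neg_zero, zero_mul, Complex.exp_zero, one_mul, smul_eq_mul]
    rw [mul_comm, real_inner_comm]
    congr 2
    push_cast
    ring
  rw [h, integral_thinGaussian hN (by simp), norm_mul, norm_mul, norm_pow, Complex.norm_exp]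
  have e1 : ((Real.pi : ℂ) / (N + 0)) ^ (1 / 2 : ℂ) = (((Real.pi / N) ^ (1 / 2 : ℝ) : ℝ) : ℂ) := by
    rw [Complex.ofReal_cpow (by positivity)]
    push_cast
    simp
  have e2 : ((Real.pi : ℂ) / (1 + 0)) ^ (1 / 2 : ℂ) = ((Real.pi ^ (1 / 2 : ℝ) : ℝ) : ℂ) := by
    rw [Complex.ofReal_cpow (by positivity)]
    push_cast
    simp
  have e3 : ((N + Real.pi * Complex.I * y 0) ^ 2 / (N + 0) - N -
      Real.pi ^ 2 * (∑ i : Fin m, (y i.succ : ℂ) ^ 2) / (1 + 0) : ℂ) =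
      ((-Real.pi ^ 2 * y 0 ^ 2 / N - Real.pi ^ 2 * ∑ i : Fin m, y i.succ ^ 2 : ℝ) : ℂ) +
        ((2 * Real.pi * y 0 : ℝ) : ℂ) * Complex.I := by
    have : (N : ℂ) ≠ 0 := by exact_mod_cast hN0.ne'
    push_cast
    rw [add_zero, add_zero, div_one]
    field_simp
    ring_nf
    rw [Complex.I_sq]
    ring
  rw [e1, e2, e3, Complex.norm_real, Complex.norm_real, Real.norm_of_nonneg (by positivity),
    Real.norm_of_nonneg (by positivity)]
  congr 2
  rw [Complex.add_re, Complex.ofReal_re, Complex.re_ofReal_mul, Complex.I_re, mul_zero, add_zero]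

/-- The linear map multiplying the zeroth coordinate by `d`. -/
noncomputable def scaleFirst (m : ℕ) (d : ℝ) :
    EuclideanSpace ℝ (Fin (m + 1)) →ₗ[ℝ] EuclideanSpace ℝ (Fin (m + 1)) :=
  Matrix.toEuclideanLin (Matrix.diagonal (Fin.cons d fun _ ↦ 1))

theorem det_scaleFirst (m : ℕ) (d : ℝ) : LinearMap.det (scaleFirst m d) = d := by
  rw [scaleFirst, Matrix.toEuclideanLin_eq_toLin_orthonormal, LinearMap.det_toLin,
    Matrix.det_diagonal, Fin.prod_univ_succ]
  simp

theorem scaleFirst_zero {m : ℕ} (d : ℝ) (y : EuclideanSpace ℝ (Fin (m + 1))) :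
    scaleFirst m d y 0 = d * y 0 := by
  simp [scaleFirst, Matrix.toLpLin_apply, Matrix.mulVec_diagonal]

theorem scaleFirst_succ {m : ℕ} (d : ℝ) (y : EuclideanSpace ℝ (Fin (m + 1))) (i : Fin m) :
    scaleFirst m d y i.succ = y i.succ := by
  simp [scaleFirst, Matrix.toLpLin_apply, Matrix.mulVec_diagonal]

/-- Only moduli agree under this scaling: the carrier wave does not depend on `M`. Moduli suffice
for `L^p` norms. -/
theorem norm_thinTest_sq {m : ℕ} {M : ℝ} (hM : 0 < M) (hN : 1 ≤ M ^ 2)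
    (y : EuclideanSpace ℝ (Fin (m + 1))) :
    ‖thinTest m hN y‖ = ‖(M⁻¹ • (thinTest m le_rfl ∘ scaleFirst m M⁻¹)) y‖ := by
  rw [Pi.smul_apply, norm_smul, Function.comp_apply, norm_thinTest, norm_thinTest,
    scaleFirst_zero, Real.norm_of_nonneg (by positivity)]
  simp only [scaleFirst_succ]
  rw [Real.div_rpow (by positivity) (by positivity), ← Real.sqrt_eq_rpow (M ^ 2),
    Real.sqrt_sq hM.le, div_one]
  have : -Real.pi ^ 2 * (M⁻¹ * y 0) ^ 2 / 1 = -Real.pi ^ 2 * y 0 ^ 2 / M ^ 2 := by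
    field_simp
  rw [this]
  field_simp

/-- The `L^p` norm of the thin test function with parameter `N = M²`. -/
theorem eLpNorm_thinTest {m : ℕ} {M : ℝ} (hM : 0 < M) (hN : 1 ≤ M ^ 2) (p : ℝ≥0∞) :
    eLpNorm (thinTest m hN) p volume =
      ENNReal.ofReal (M ^ ((1 / p).toReal - 1)) * eLpNorm (thinTest m le_rfl) p volume := by
  have hdet : LinearMap.det (scaleFirst m M⁻¹) ≠ 0 := by
    rw [det_scaleFirst]; positivity
  have hmeas : Measurable (scaleFirst m M⁻¹) :=
    (LinearMap.continuous_of_finiteDimensional _).measurable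
  rw [eLpNorm_congr_norm_ae (ae_of_all _ (norm_thinTest_sq hM hN)), eLpNorm_const_smul,
    ← eLpNorm_map_measure (SchwartzMap.continuous _).aestronglyMeasurable hmeas.aemeasurable,
    Measure.map_linearMap_addHaar_eq_smul_addHaar _ hdet, det_scaleFirst, inv_inv, abs_of_pos hM,
    eLpNorm_smul_measure_of_ne_zero (by simpa using hM), smul_eq_mul, ← mul_assoc,
    Real.enorm_of_nonneg (by positivity), ENNReal.ofReal_rpow_of_pos hM,
    ← ENNReal.ofReal_mul (by positivity), Real.rpow_sub hM, Real.rpow_one]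
  congr 2
  field_simp

/-! ### Laplace transforms of powers -/

/-- The Laplace transform of `s ^ lam` at a complex point of the right half plane. -/
theorem integral_rpow_mul_cexp_neg_mul_Ioi {lam : ℝ} (hlam : 0 < lam) {z : ℂ} (hz : 0 < z.re) :
    ∫ s in Set.Ioi (0 : ℝ), ((s ^ lam : ℝ) : ℂ) * Complex.exp (-z * s) =
      (1 / z) ^ ((lam : ℂ) + 1) * Complex.Gamma (lam + 1) := by
  -- Against the measure `s ^ lam ds` the integral is the complex moment generating function of
  -- `-s`, hence analytic in the right half plane. The identity theorem extends the Gamma integral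
  -- from positive real `z`.
  let d : ℝ → ℝ≥0 := fun s ↦ Real.toNNReal (s ^ lam)
  have hd : Measurable d := by fun_prop
  let μ : Measure ℝ := (volume.restrict (Set.Ioi 0)).withDensity fun s ↦ (d s : ℝ≥0∞)
  have hmgf : ∀ w, ProbabilityTheory.complexMGF (fun s : ℝ ↦ -s) μ w =
      ∫ s in Set.Ioi (0 : ℝ), ((s ^ lam : ℝ) : ℂ) * Complex.exp (-w * s) := by
    intro w
    rw [ProbabilityTheory.complexMGF, integral_withDensity_eq_integral_smul hd]
    refine setIntegral_congr_fun measurableSet_Ioi fun s hs ↦ ?_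
    have hs' : (0 : ℝ) ≤ s ^ lam := Real.rpow_nonneg (le_of_lt hs) _
    simp only [d, NNReal.smul_def, Real.coe_toNNReal _ hs', Complex.real_smul]
    push_cast
    ring_nf
  have hset : Set.Ioi (0 : ℝ) ⊆ ProbabilityTheory.integrableExpSet (fun s : ℝ ↦ -s) μ := by
    intro t ht
    change Integrable (fun s : ℝ ↦ Real.exp (t * -s)) μ
    rw [integrable_withDensity_iff_integrable_smul hd]
    refine (integrableOn_rpow_mul_exp_neg_mul_rpow (s := lam) (p := 1) (b := t) (by linarith)
      one_pos ht).congr_fun (fun s hs ↦ ?_) measurableSet_Ioi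
    have hs' : (0 : ℝ) ≤ s ^ lam := Real.rpow_nonneg (le_of_lt hs) _
    simp only [d, NNReal.smul_def, Real.coe_toNNReal _ hs', smul_eq_mul, Real.rpow_one]
    ring_nf
  let U : Set ℂ := {w | 0 < w.re}
  have hUo : IsOpen U := isOpen_lt continuous_const Complex.continuous_re
  have hUc : IsPreconnected U := (convex_halfSpace_re_gt 0).isPreconnected
  have hleft : AnalyticOnNhd ℂ (ProbabilityTheory.complexMGF (fun s : ℝ ↦ -s) μ) U :=
    ProbabilityTheory.analyticOnNhd_complexMGF.mono fun w hw ↦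
      interior_mono hset (by rwa [interior_Ioi])
  have hright : AnalyticOnNhd ℂ
      (fun w : ℂ ↦ (1 / w) ^ ((lam : ℂ) + 1) * Complex.Gamma (lam + 1)) U := by
    refine DifferentiableOn.analyticOnNhd (fun w hw ↦ ?_) hUo
    have hw0 : w ≠ 0 := fun h ↦ by simp [U, h] at hw
    have hsl : 1 / w ∈ Complex.slitPlane := by
      left
      rw [one_div, Complex.inv_re]
      exact div_pos hw (Complex.normSq_pos.2 hw0)
    refine (DifferentiableAt.mul_const ?_ _).differentiableWithinAt
    exact ((differentiableAt_const _).div differentiableAt_id hw0).cpow_const hsl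
  have hreal : ∀ t : ℝ, 0 < t → ProbabilityTheory.complexMGF (fun s : ℝ ↦ -s) μ t =
      (1 / (t : ℂ)) ^ ((lam : ℂ) + 1) * Complex.Gamma (lam + 1) := by
    intro t ht
    rw [hmgf, ← Complex.integral_cpow_mul_exp_neg_mul_Ioi (by simp; linarith) ht]
    refine setIntegral_congr_fun measurableSet_Ioi fun s hs ↦ ?_
    simp only [add_sub_cancel_right, Complex.ofReal_cpow (le_of_lt hs), neg_mul]
  have hfreq : ∃ᶠ w in nhdsWithin (1 : ℂ) {1}ᶜ,
      ProbabilityTheory.complexMGF (fun s : ℝ ↦ -s) μ w =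
      (1 / w) ^ ((lam : ℂ) + 1) * Complex.Gamma (lam + 1) := by
    have ht : Filter.Tendsto (fun t : ℝ ↦ (t : ℂ)) (nhdsWithin 1 {1}ᶜ)
        (nhdsWithin (1 : ℂ) {1}ᶜ) := by
      refine tendsto_nhdsWithin_of_tendsto_nhds_of_eventually_within _ ?_ ?_
      · exact ((Complex.continuous_ofReal.tendsto 1).mono_left nhdsWithin_le_nhds)
      · filter_upwards [self_mem_nhdsWithin] with t ht
        simpa using ht
    refine ht.frequently (Filter.Eventually.frequently ?_)
    filter_upwards [nhdsWithin_le_nhds (lt_mem_nhds (zero_lt_one' ℝ))] with t h using hreal t h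
  have := hleft.eqOn_of_preconnected_of_frequently_eq hright hUc (z₀ := 1) (by simp [U]) hfreq hz
  rw [← hmgf, this]

/-- The Laplace transform of the truncated power `(r - u)₊ ^ lam`. -/
theorem integral_max_sub_rpow_mul_cexp_neg_mul {lam : ℝ} (hlam : 0 < lam) {z : ℂ} (hz : 0 < z.re)
    (u : ℝ) :
    ∫ r : ℝ, ((max (r - u) 0 ^ lam : ℝ) : ℂ) * Complex.exp (-z * r) =
      Complex.exp (-z * u) * ((1 / z) ^ ((lam : ℂ) + 1) * Complex.Gamma (lam + 1)) := by
  rw [← integral_rpow_mul_cexp_neg_mul_Ioi hlam hz, ← integral_const_mul,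
    ← integral_add_right_eq_self _ u, ← integral_indicator measurableSet_Ioi]
  refine integral_congr_ae (ae_of_all _ fun s ↦ ?_)
  by_cases hs : s ∈ Set.Ioi (0 : ℝ)
  · simp only [Set.indicator_of_mem hs, add_sub_cancel_right, max_eq_left (Set.mem_Ioi.1 hs).le]
    have : -z * ((s + u : ℝ) : ℂ) = -z * u + -z * s := by push_cast; ring
    rw [this, Complex.exp_add]
    ring
  · rw [Set.indicator_of_notMem hs]
    simp [max_eq_right (Set.notMem_Ioi.1 hs), Real.zero_rpow (ne_of_gt hlam)]

/-! ### Averages of truncated powers -/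

theorem exists_max_rpow_mul_exp_neg_le (lam : ℝ) (hlam : 0 < lam) :
    ∃ K : ℝ, 0 < K ∧ ∀ r : ℝ, max r 0 ^ lam * Real.exp (-r) ≤ K := by
  obtain ⟨k, hk⟩ := exists_nat_ge lam
  refine ⟨k.factorial * Real.exp 1, by positivity, fun r ↦ ?_⟩
  rcases le_or_gt r 0 with hr | hr
  · rw [max_eq_right hr, Real.zero_rpow hlam.ne', zero_mul]
    positivity
  · rw [max_eq_left hr.le]
    have h1 : r ^ lam ≤ (1 + r) ^ k := by
      calc r ^ lam ≤ (1 + r) ^ lam := by gcongr; linarith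
        _ ≤ (1 + r) ^ (k : ℝ) := Real.rpow_le_rpow_of_exponent_le (by linarith) hk
        _ = _ := Real.rpow_natCast _ _
    have h2 := Real.pow_div_factorial_le_exp (1 + r) (by positivity) k
    rw [div_le_iff₀ (by positivity)] at h2
    calc r ^ lam * Real.exp (-r) ≤ (Real.exp (1 + r) * k.factorial) * Real.exp (-r) := by
          gcongr
          exact h1.trans h2
      _ = _ := by
        rw [Real.exp_add, Real.exp_neg]
        field_simp

theorem integrable_max_rpow_mul_exp_neg_mul {lam : ℝ} (hlam : 0 < lam) {a : ℝ} (ha : 0 < a) :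
    Integrable fun r : ℝ ↦ max r 0 ^ lam * Real.exp (-a * r) := by
  have h := (integrableOn_rpow_mul_exp_neg_mul_rpow (s := lam) (p := 1) (b := a) (by linarith)
      one_pos ha)
  rw [← integrable_indicator_iff measurableSet_Ioi] at h
  refine h.congr (ae_of_all _ fun r ↦ ?_)
  by_cases hr : r ∈ Set.Ioi (0 : ℝ)
  · simp [Set.indicator_of_mem hr, max_eq_left (Set.mem_Ioi.1 hr).le]
  · simp [Set.indicator_of_notMem hr, max_eq_right (Set.notMem_Ioi.1 hr),
      Real.zero_rpow hlam.ne']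

section Profile

variable {Z : Type*} [MeasurableSpace Z] {ν : Measure Z} {u : Z → ℝ} {Φ : Z → ℂ}
  {lam : ℝ} {z : ℂ}

/-- Since `u ≥ 0`, the integrand is dominated by the tensor product of `r₊ ^ lam exp (-Re z · r)`
and `|Φ|`. This is what licenses Fubini for the Laplace transform. -/
theorem integrable_prod_max_sub_rpow (hlam : 0 < lam) (hu : Measurable u) (hu0 : ∀ ζ, 0 ≤ u ζ)
    (hΦ : Integrable Φ ν) (hz : 0 < z.re) :
    Integrable (fun q : ℝ × Z ↦
      ((max (q.1 - u q.2) 0 ^ lam : ℝ) : ℂ) * Complex.exp (-z * q.1) * Φ q.2)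
      ((volume : Measure ℝ).prod ν) := by
  refine Integrable.mono' ((integrable_max_rpow_mul_exp_neg_mul hlam hz).mul_prod hΦ.norm)
    ?_ (ae_of_all _ fun q ↦ ?_)
  · refine AEStronglyMeasurable.mul (Measurable.aestronglyMeasurable ?_) hΦ.1.comp_snd
    fun_prop
  · have h1 : max (q.1 - u q.2) 0 ^ lam ≤ max q.1 0 ^ lam := by
      have := hu0 q.2
      gcongr
      linarith
    rw [norm_mul, norm_mul, Complex.norm_real, Complex.norm_exp,
      Real.norm_of_nonneg (by positivity)]
    simp only [Complex.re_mul_ofReal, Complex.neg_re]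
    gcongr

/-- The Laplace transform of `r ↦ ∫ (r - u)₊ ^ lam Φ`. -/
theorem integral_integral_max_sub_rpow [SFinite ν] (hlam : 0 < lam) (hu : Measurable u) (hu0 : ∀ ζ, 0 ≤ u ζ)
    (hΦ : Integrable Φ ν) (hz : 0 < z.re) :
    ∫ r : ℝ, Complex.exp (-z * r) * ∫ ζ, ((max (r - u ζ) 0 ^ lam : ℝ) : ℂ) * Φ ζ ∂ν =
      (1 / z) ^ ((lam : ℂ) + 1) * Complex.Gamma (lam + 1) *
        ∫ ζ, Complex.exp (-z * u ζ) * Φ ζ ∂ν := by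
  have h := integrable_prod_max_sub_rpow hlam hu hu0 hΦ hz
  calc _ = ∫ r : ℝ, ∫ ζ, ((max (r - u ζ) 0 ^ lam : ℝ) : ℂ) * Complex.exp (-z * r) * Φ ζ ∂ν := by
        refine integral_congr_ae (ae_of_all _ fun r ↦ ?_)
        simp only
        rw [← integral_const_mul]
        refine integral_congr_ae (ae_of_all _ fun ζ ↦ ?_)
        simp only
        ring
    _ = ∫ ζ, (∫ r : ℝ, ((max (r - u ζ) 0 ^ lam : ℝ) : ℂ) * Complex.exp (-z * r) * Φ ζ) ∂ν :=
        integral_integral_swap h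
    _ = _ := by
        rw [← integral_const_mul]
        refine integral_congr_ae (ae_of_all _ fun ζ ↦ ?_)
        simp only
        rw [integral_mul_const, integral_max_sub_rpow_mul_cexp_neg_mul hlam hz]
        ring

theorem integrable_cexp_neg_mul_integral_max_sub_rpow [SFinite ν] (hlam : 0 < lam) (hu : Measurable u)
    (hu0 : ∀ ζ, 0 ≤ u ζ) (hΦ : Integrable Φ ν) (hz : 0 < z.re) :
    Integrable fun r : ℝ ↦
      Complex.exp (-z * r) * ∫ ζ, ((max (r - u ζ) 0 ^ lam : ℝ) : ℂ) * Φ ζ ∂ν := by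
  refine (integrable_prod_max_sub_rpow hlam hu hu0 hΦ hz).integral_prod_left.congr
    (ae_of_all _ fun r ↦ ?_)
  simp only
  rw [← integral_const_mul]
  refine integral_congr_ae (ae_of_all _ fun ζ ↦ ?_)
  simp only
  ring

end Profile

/-! ### Averages of the bilinear Bochner-Riesz means -/

section Average

variable {n : ℕ} (lam : ℝ) (f g : 𝓢(EuclideanSpace ℝ (Fin n), ℂ)) (x : EuclideanSpace ℝ (Fin n))

/-- The Fourier side density `𝓕f(ξ) 𝓕g(η) exp(2πi x·(ξ + η))`. -/
noncomputable def fourierDensity (ζ : EuclideanSpace ℝ (Fin n) × EuclideanSpace ℝ (Fin n)) : ℂ :=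
  (𝓕 (f : EuclideanSpace ℝ (Fin n) → ℂ) ζ.1 *
      Complex.exp (2 * Real.pi * Complex.I * (inner ℝ x ζ.1 : ℝ))) *
    (𝓕 (g : EuclideanSpace ℝ (Fin n) → ℂ) ζ.2 *
      Complex.exp (2 * Real.pi * Complex.I * (inner ℝ x ζ.2 : ℝ)))

/-- The rescaled mean `r ^ lam * A_{r^{-1/2}}(f, g)(x)`, extended by zero to `r ≤ 0`. -/
noncomputable def brProfile (r : ℝ) : ℂ :=
  ∫ ζ : EuclideanSpace ℝ (Fin n) × EuclideanSpace ℝ (Fin n),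
    ((max (r - (‖ζ.1‖ ^ 2 + ‖ζ.2‖ ^ 2)) 0 ^ lam : ℝ) : ℂ) * fourierDensity f g x ζ

theorem norm_cexp_two_pi_I_mul (a : ℝ) :
    ‖Complex.exp (2 * Real.pi * Complex.I * (a : ℂ))‖ = 1 := by
  have : (2 * Real.pi * Complex.I * (a : ℂ)) = ((2 * Real.pi * a : ℝ) : ℂ) * Complex.I := by
    push_cast; ring
  rw [this, Complex.norm_exp_ofReal_mul_I]

theorem integrable_fourier_mul_cexp :
    Integrable fun ξ ↦ 𝓕 (f : EuclideanSpace ℝ (Fin n) → ℂ) ξ *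
      Complex.exp (2 * Real.pi * Complex.I * (inner ℝ x ξ : ℝ)) := by
  have h : Integrable (𝓕 (f : EuclideanSpace ℝ (Fin n) → ℂ)) := by
    rw [← SchwartzMap.fourier_coe]
    exact SchwartzMap.integrable _
  refine h.mul_bdd (c := 1) (Continuous.aestronglyMeasurable (by fun_prop))
    (ae_of_all _ fun ξ ↦ (norm_cexp_two_pi_I_mul _).le)

theorem integrable_fourierDensity : Integrable (fourierDensity f g x) :=
  (integrable_fourier_mul_cexp f x).mul_prod (integrable_fourier_mul_cexp g x)

theorem measurable_normSq_add_normSq :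
    Measurable fun ζ : EuclideanSpace ℝ (Fin n) × EuclideanSpace ℝ (Fin n) ↦
      ‖ζ.1‖ ^ 2 + ‖ζ.2‖ ^ 2 := by
  fun_prop

variable {lam}

/-- Homogeneity of the truncated power under `t = r^{-1/2}`. In this form `r` enters only as a
translation of the truncated power, so the Laplace transform factors. -/
theorem brProfile_eq (hlam : 0 < lam) {r : ℝ} (hr : 0 < r) :
    brProfile lam f g x r = ((r ^ lam : ℝ) : ℂ) * bilinearBR lam (√r)⁻¹ f g x := by
  have hint : Integrable fun ζ : EuclideanSpace ℝ (Fin n) × EuclideanSpace ℝ (Fin n) ↦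
      ((max (r - (‖ζ.1‖ ^ 2 + ‖ζ.2‖ ^ 2)) 0 ^ lam : ℝ) : ℂ) * fourierDensity f g x ζ := by
    refine (integrable_fourierDensity f g x).bdd_mul (c := r ^ lam)
      (Measurable.aestronglyMeasurable (by fun_prop)) (ae_of_all _ fun ζ ↦ ?_)
    rw [Complex.norm_real, Real.norm_of_nonneg (by positivity)]
    gcongr
    exact max_le (by nlinarith [sq_nonneg ‖ζ.1‖, sq_nonneg ‖ζ.2‖]) hr.le
  rw [brProfile, Measure.volume_eq_prod, integral_prod _ hint, bilinearBR, ← integral_const_mul]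
  refine integral_congr_ae (ae_of_all _ fun ξ ↦ ?_)
  simp only
  rw [← integral_const_mul]
  refine integral_congr_ae (ae_of_all _ fun η ↦ ?_)
  have hm : max (r - (‖ξ‖ ^ 2 + ‖η‖ ^ 2)) 0 ^ lam =
      r ^ lam * brMultiplier lam ((√r)⁻¹ • ξ) ((√r)⁻¹ • η) := by
    rw [brMultiplier, ← Real.mul_rpow hr.le (le_max_right _ _), mul_max_of_nonneg _ _ hr.le,
      mul_zero, norm_smul, norm_smul, mul_pow, mul_pow, norm_inv, inv_pow, Real.norm_eq_abs,
      sq_abs, Real.sq_sqrt hr.le]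
    congr 2
    field_simp
  simp only [hm, fourierDensity, inner_add_right]
  push_cast
  rw [mul_add (2 * Real.pi * Complex.I), Complex.exp_add]
  ring

theorem brProfile_of_nonpos (hlam : 0 < lam) {r : ℝ} (hr : r ≤ 0) :
    brProfile lam f g x r = 0 := by
  have : ∀ ζ : EuclideanSpace ℝ (Fin n) × EuclideanSpace ℝ (Fin n),
      max (r - (‖ζ.1‖ ^ 2 + ‖ζ.2‖ ^ 2)) 0 ^ lam = 0 := fun ζ ↦ by
    rw [max_eq_right (by nlinarith [sq_nonneg ‖ζ.1‖, sq_nonneg ‖ζ.2‖]), Real.zero_rpow hlam.ne']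
  simp [brProfile, this]

/-- Supplies the envelope hypothesis of `exists_norm_window_laplace_le`, with `S` the value of the
maximal function. -/
theorem norm_brProfile_le (hlam : 0 < lam) {S : ℝ}
    (hS : ∀ t : ℝ, 0 < t → ‖bilinearBR lam t f g x‖ ≤ S) (r : ℝ) :
    ‖brProfile lam f g x r‖ ≤ max r 0 ^ lam * S := by
  rcases le_or_gt r 0 with hr | hr
  · rw [brProfile_of_nonpos f g x hlam hr, norm_zero, max_eq_right hr, Real.zero_rpow hlam.ne',
      zero_mul]
  · rw [brProfile_eq f g x hlam hr, norm_mul, Complex.norm_real, max_eq_left hr.le,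
      Real.norm_of_nonneg (by positivity)]
    have := hS (√r)⁻¹ (by positivity)
    gcongr

/-- The Laplace transform in `r = t⁻²` of the bilinear Bochner-Riesz means is a product of two
complex heat evolutions. -/
theorem integral_brProfile (hlam : 0 < lam) {z : ℂ} (hz : 0 < z.re) :
    ∫ r : ℝ, Complex.exp (-z * r) * brProfile lam f g x r =
      (1 / z) ^ ((lam : ℂ) + 1) * Complex.Gamma (lam + 1) *
        ((∫ ξ, Complex.exp (-z * (‖ξ‖ ^ 2 : ℝ)) * 𝓕 (f : EuclideanSpace ℝ (Fin n) → ℂ) ξ *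
            Complex.exp (2 * Real.pi * Complex.I * (inner ℝ x ξ : ℝ))) *
          ∫ η, Complex.exp (-z * (‖η‖ ^ 2 : ℝ)) * 𝓕 (g : EuclideanSpace ℝ (Fin n) → ℂ) η *
            Complex.exp (2 * Real.pi * Complex.I * (inner ℝ x η : ℝ))) := by
  unfold brProfile
  rw [integral_integral_max_sub_rpow hlam measurable_normSq_add_normSq
    (fun ζ ↦ by positivity) (integrable_fourierDensity f g x) hz, ← integral_prod_mul]
  congr 1
  rw [Measure.volume_eq_prod]
  refine integral_congr_ae (ae_of_all _ fun ζ ↦ ?_)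
  simp only [fourierDensity]
  push_cast
  rw [mul_add, Complex.exp_add]
  ring

theorem integrable_brProfile (hlam : 0 < lam) {z : ℂ} (hz : 0 < z.re) :
    Integrable fun r : ℝ ↦ Complex.exp (-z * r) * brProfile lam f g x r :=
  integrable_cexp_neg_mul_integral_max_sub_rpow hlam measurable_normSq_add_normSq
    (fun ζ ↦ by positivity) (integrable_fourierDensity f g x) hz

end Average

/-- Testing the Laplace transform of `G` on a vertical line against a window of width `M` bounds
the size of `G` from below. -/
theorem exists_norm_window_laplace_le {lam : ℝ} (hlam : 0 < lam) (ρ : 𝓢(ℝ, ℂ)) :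
    ∃ K : ℝ, 0 < K ∧ ∀ (G : ℝ → ℂ) (S M θ r₀ : ℝ), 0 < M →
      (∀ r, ‖G r‖ ≤ max r 0 ^ lam * S) →
      Integrable (fun r : ℝ ↦ Complex.exp (-(1 : ℂ) * r) * G r) →
      ‖∫ s : ℝ, ρ s * Complex.exp (Complex.I * (M * s * r₀ : ℝ)) *
        ∫ r : ℝ, Complex.exp (-(1 + Complex.I * (θ + M * s : ℝ)) * r) * G r‖ ≤ K * S / M := by
  obtain ⟨K, hK0, hK⟩ := exists_max_rpow_mul_exp_neg_le lam hlam
  have hρ' : Integrable (𝓕 (ρ : ℝ → ℂ)) := by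
    rw [← SchwartzMap.fourier_coe]; exact SchwartzMap.integrable _
  set B := ∫ w, ‖𝓕 (ρ : ℝ → ℂ) w‖
  have hB0 : 0 ≤ B := integral_nonneg fun _ ↦ norm_nonneg _
  refine ⟨K * (2 * Real.pi) * (B + 1), by positivity, fun G S M θ r₀ hM hG hint ↦ ?_⟩
  have hS : 0 ≤ S := by
    have := (norm_nonneg _).trans (hG 1)
    simpa using this
  let H : ℝ → ℂ := fun r ↦ Complex.exp (-(1 : ℂ) * r) * G r
  have hfub : Integrable (fun q : ℝ × ℝ ↦ (ρ q.1 * H q.2) *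
      Complex.exp (((M * q.1 * r₀ - (θ + M * q.1) * q.2 : ℝ) : ℂ) * Complex.I))
      ((volume : Measure ℝ).prod volume) :=
    (ρ.integrable.mul_prod hint).mul_bdd (c := 1)
      (Continuous.aestronglyMeasurable (by fun_prop))
      (ae_of_all _ fun q ↦ (Complex.norm_exp_ofReal_mul_I _).le)
  -- Integrating in `s` first turns the window into `𝓕 ρ` at scale `1/M` around `r₀`; its `L¹` norm
  -- supplies the factor `1/M`.
  have hswap : ∫ s : ℝ, ρ s * Complex.exp (Complex.I * (M * s * r₀ : ℝ)) *
        ∫ r : ℝ, Complex.exp (-(1 + Complex.I * (θ + M * s : ℝ)) * r) * G r =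
      ∫ r : ℝ, (H r * Complex.exp (((-θ * r : ℝ) : ℂ) * Complex.I)) *
        𝓕 (ρ : ℝ → ℂ) (M / (2 * Real.pi) * (r - r₀)) := by
    calc _ = ∫ s : ℝ, ∫ r : ℝ, (ρ s * H r) *
          Complex.exp (((M * s * r₀ - (θ + M * s) * r : ℝ) : ℂ) * Complex.I) := by
          refine integral_congr_ae (ae_of_all _ fun s ↦ ?_)
          simp only
          rw [← integral_const_mul]
          refine integral_congr_ae (ae_of_all _ fun r ↦ ?_)
          simp only [H]
          have : Complex.exp (Complex.I * (M * s * r₀ : ℝ)) *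
              Complex.exp (-(1 + Complex.I * (θ + M * s : ℝ)) * r) = Complex.exp (-(1 : ℂ) * r) *
              Complex.exp (((M * s * r₀ - (θ + M * s) * r : ℝ) : ℂ) * Complex.I) := by
            rw [← Complex.exp_add, ← Complex.exp_add]
            congr 1
            push_cast
            ring
          linear_combination (ρ s * G r) * this
      _ = ∫ r : ℝ, ∫ s : ℝ, (ρ s * H r) *
          Complex.exp (((M * s * r₀ - (θ + M * s) * r : ℝ) : ℂ) * Complex.I) :=
          integral_integral_swap hfub
      _ = _ := by
          refine integral_congr_ae (ae_of_all _ fun r ↦ ?_)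
          simp only
          rw [Real.fourier_real_eq_integral_exp_smul, ← integral_const_mul]
          refine integral_congr_ae (ae_of_all _ fun s ↦ ?_)
          simp only [smul_eq_mul]
          have : Complex.exp (((M * s * r₀ - (θ + M * s) * r : ℝ) : ℂ) * Complex.I) =
              Complex.exp (((-θ * r : ℝ) : ℂ) * Complex.I) *
              Complex.exp (((-2 * Real.pi * s * (M / (2 * Real.pi) * (r - r₀)) : ℝ) : ℂ) *
                Complex.I) := by
            rw [← Complex.exp_add, ← add_mul]
            congr 2
            rw [← Complex.ofReal_add]
            congr 1
            field_simp
            ring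
          rw [this]
          ring
  have hscale : ∫ r : ℝ, ‖𝓕 (ρ : ℝ → ℂ) (M / (2 * Real.pi) * (r - r₀))‖ =
      (2 * Real.pi) / M * B := by
    rw [integral_sub_right_eq_self (fun r ↦ ‖𝓕 (ρ : ℝ → ℂ) (M / (2 * Real.pi) * r)‖) r₀,
      Measure.integral_comp_mul_left (fun r ↦ ‖𝓕 (ρ : ℝ → ℂ) r‖), smul_eq_mul, abs_inv,
      abs_of_pos (by positivity), inv_div]
  have hintF : Integrable fun r : ℝ ↦ ‖𝓕 (ρ : ℝ → ℂ) (M / (2 * Real.pi) * (r - r₀))‖ :=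
    ((hρ'.norm.comp_mul_left' (R := M / (2 * Real.pi)) (by positivity)).comp_sub_right r₀)
  rw [hswap]
  calc _ ≤ ∫ r : ℝ, K * S * ‖𝓕 (ρ : ℝ → ℂ) (M / (2 * Real.pi) * (r - r₀))‖ := by
        refine norm_integral_le_of_norm_le (hintF.const_mul _) (ae_of_all _ fun r ↦ ?_)
        rw [norm_mul, norm_mul, Complex.norm_exp_ofReal_mul_I, mul_one]
        gcongr
        simp only [H]
        rw [norm_mul, Complex.norm_exp]
        have h1 := hG r
        have h2 := hK r
        simp only [neg_mul, one_mul, Complex.neg_re, Complex.ofReal_re]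
        calc _ ≤ Real.exp (-r) * (max r 0 ^ lam * S) := by gcongr
          _ = (max r 0 ^ lam * Real.exp (-r)) * S := by ring
          _ ≤ _ := by gcongr
    _ = K * S * ((2 * Real.pi) / M * B) := by rw [integral_const_mul, hscale]
    _ = K * (2 * Real.pi) * B * S / M := by ring
    _ ≤ _ := by gcongr; linarith

/-! ### The lower bound for the maximal function of the thin test function -/

theorem Complex.ofReal_mul_cpow {a : ℝ} (ha : 0 < a) {w : ℂ} (hw : w ≠ 0) (r : ℝ) :
    ((a : ℂ) * w) ^ (r : ℂ) = ((a ^ r : ℝ) : ℂ) * w ^ (r : ℂ) := by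
  have ha' : (a : ℂ) ≠ 0 := by exact_mod_cast ha.ne'
  rw [Complex.ofReal_cpow ha.le, Complex.cpow_def_of_ne_zero (mul_ne_zero ha' hw),
    Complex.cpow_def_of_ne_zero ha', Complex.cpow_def_of_ne_zero hw, Complex.log_ofReal_mul ha hw,
    ← Complex.exp_add, Complex.ofReal_log ha.le]
  ring_nf

/-- The point `k + i (b + ε s) + l ε²` of the right half plane. -/
noncomputable def windowPoint (k l ε b s : ℝ) : ℂ :=
  k + Complex.I * (b + ε * s : ℝ) + (l * ε ^ 2 : ℝ)

theorem windowPoint_re (k l ε b s : ℝ) : (windowPoint k l ε b s).re = k + l * ε ^ 2 := by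
  simp only [windowPoint, Complex.add_re, Complex.ofReal_re, Complex.I_mul_re, Complex.ofReal_im,
    neg_zero, add_zero]

theorem windowPoint_im (k l ε b s : ℝ) : (windowPoint k l ε b s).im = b + ε * s := by
  simp only [windowPoint, Complex.add_im, Complex.ofReal_im, Complex.I_mul_im, Complex.ofReal_re,
    zero_add, add_zero]

/-- The value `ε = 0` is deliberately included, where the real part may vanish: the limit `M → ∞` is
taken by continuity at `ε = 0`. -/
theorem windowPoint_re_pos_or_im_pos {k l ε b : ℝ} (hk : 0 ≤ k) (hl : 0 < l) (hb : 0 < b) (s : ℝ) :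
    0 < (windowPoint k l ε b s).re ∨ 0 < (windowPoint k l ε b s).im := by
  rw [windowPoint_re, windowPoint_im]
  rcases eq_or_ne ε 0 with rfl | hε
  · right; simpa using hb
  · left; positivity

theorem windowPoint_ne_zero {k l ε b : ℝ} (hk : 0 ≤ k) (hl : 0 < l) (hb : 0 < b) (s : ℝ) :
    windowPoint k l ε b s ≠ 0 := by
  intro h
  rcases windowPoint_re_pos_or_im_pos (ε := ε) hk hl hb s with h' | h' <;> simp [h] at h'

theorem one_div_windowPoint_mem_slitPlane {k l ε b : ℝ} (hk : 0 ≤ k) (hl : 0 < l) (hb : 0 < b)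
    (s : ℝ) : 1 / windowPoint k l ε b s ∈ Complex.slitPlane := by
  have hn := Complex.normSq_pos.2 (windowPoint_ne_zero (ε := ε) hk hl hb s)
  rw [Complex.mem_slitPlane_iff, one_div, Complex.inv_re, Complex.inv_im]
  rcases windowPoint_re_pos_or_im_pos (ε := ε) hk hl hb s with h' | h'
  · exact Or.inl (div_pos h' hn)
  · exact Or.inr (div_ne_zero (neg_ne_zero.2 h'.ne') (ne_of_gt hn))

/-- The normalized Laplace transform of the Bochner-Riesz means of the thin test function, along
the window `s`, where `ε = N^{-1/2}`. -/
noncomputable def windowSymbol (lam : ℝ) (m : ℕ) (P : ℝ × ℝ × ℝ) (s : ℝ) : ℂ :=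
  (1 / windowPoint 0 1 P.1 P.2.1 s) ^ ((lam + 1 : ℝ) : ℂ) *
    (Real.pi / windowPoint 1 1 P.1 P.2.1 s) * (Real.pi / windowPoint 0 2 P.1 P.2.1 s) ^ m *
    Complex.exp (-2 - 4 * P.2.2 +
      2 * (Complex.I * s + P.1) ^ 2 / windowPoint 1 1 P.1 P.2.1 s +
      2 * P.2.2 * (Complex.I * s + 2 * P.1) ^ 2 / windowPoint 0 2 P.1 P.2.1 s)

theorem continuousOn_windowSymbol (lam : ℝ) (m : ℕ) :
    ContinuousOn (Function.uncurry (windowSymbol lam m))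
      ({P : ℝ × ℝ × ℝ | 0 < P.2.1} ×ˢ Set.univ) := by
  have hc (k l : ℝ) : Continuous fun Q : (ℝ × ℝ × ℝ) × ℝ ↦
      windowPoint k l Q.1.1 Q.1.2.1 Q.2 := by
    unfold windowPoint
    fun_prop
  rintro Q ⟨hQ, -⟩
  have hb : 0 < Q.1.2.1 := hQ
  have hB1 := windowPoint_ne_zero (ε := Q.1.1) le_rfl one_pos hb Q.2
  have hA := windowPoint_ne_zero (ε := Q.1.1) zero_le_one one_pos hb Q.2
  have hB2 := windowPoint_ne_zero (ε := Q.1.1) le_rfl two_pos hb Q.2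
  have hsl := one_div_windowPoint_mem_slitPlane (ε := Q.1.1) le_rfl one_pos hb Q.2
  refine ContinuousAt.continuousWithinAt ?_
  have c1 := (hc 0 1).continuousAt (x := Q)
  have c2 := (hc 1 1).continuousAt (x := Q)
  have c3 := (hc 0 2).continuousAt (x := Q)
  unfold Function.uncurry windowSymbol
  refine ContinuousAt.mul (ContinuousAt.mul (ContinuousAt.mul ?_ ?_) ?_) ?_
  · exact (continuousAt_const.div c1 hB1).cpow continuousAt_const hsl
  · exact continuousAt_const.div c2 hA
  · exact (continuousAt_const.div c3 hB2).pow m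
  · refine ContinuousAt.cexp (ContinuousAt.add (ContinuousAt.add ?_ ?_) ?_)
    · fun_prop
    · exact ContinuousAt.div (by fun_prop) c2 hA
    · exact ContinuousAt.div (by fun_prop) c3 hB2

/-- A smooth bump on `ℝ` supported in the unit interval around the origin. -/
noncomputable def unitBump : ContDiffBump (0 : ℝ) := ⟨1 / 2, 1, by norm_num, by norm_num⟩

/-- The bump `unitBump` as a complex valued Schwartz function. -/
noncomputable def unitWindow : 𝓢(ℝ, ℂ) :=
  SchwartzMap.postcompCLM Complex.ofRealCLM
    (unitBump.hasCompactSupport.toSchwartzMap unitBump.contDiff)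

theorem unitWindow_apply (s : ℝ) : unitWindow s = (unitBump s : ℂ) := rfl

theorem unitBump_eq_zero {s : ℝ} (hs : s ∉ Set.Icc (-1 : ℝ) 1) : unitBump s = 0 := by
  apply unitBump.zero_of_le_dist
  simp only [Real.dist_eq, sub_zero, unitBump]
  rw [Set.mem_Icc, ← abs_le, not_le] at hs
  exact hs.le

theorem continuousOn_integral_windowSymbol (lam : ℝ) (m : ℕ) :
    ContinuousOn (fun P ↦ ∫ s, unitWindow s * windowSymbol lam m P s)
      {P : ℝ × ℝ × ℝ | 0 < P.2.1} := by
  refine continuousOn_integral_of_compact_support (k := Set.Icc (-1) 1) isCompact_Icc ?_ ?_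
  · exact ((unitWindow.continuous.comp continuous_snd).continuousOn).mul
      (continuousOn_windowSymbol lam m)
  · intro P s _ hs
    rw [unitWindow_apply, unitBump_eq_zero hs]
    simp

/-- The real part is positive: on the support of the bump the phase is `2 s² b / (1 + b²)`, at most
`1 < π/2` in absolute value because `2|b| ≤ 1 + b²`. -/
theorem integral_unitWindow_mul_cexp_ne_zero {b : ℝ} :
    ∫ s : ℝ, unitWindow s * Complex.exp (2 * (Complex.I * s) ^ 2 / (1 + Complex.I * b)) ≠ 0 := by
  have hd : (0 : ℝ) < 1 + b ^ 2 := by positivity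
  have hb0 : (1 : ℂ) + Complex.I * b ≠ 0 := fun h ↦ by
    have := congrArg Complex.re h
    simp at this
  have hexp : ∀ s : ℝ, 2 * (Complex.I * s) ^ 2 / (1 + Complex.I * b) =
      ((-(2 * s ^ 2) / (1 + b ^ 2) : ℝ) : ℂ) + ((2 * s ^ 2 * b / (1 + b ^ 2) : ℝ) : ℂ) *
        Complex.I := by
    intro s
    have hd' : (1 : ℂ) + (b : ℂ) ^ 2 ≠ 0 := by exact_mod_cast hd.ne'
    push_cast
    field_simp
    ring_nf
    simp only [Complex.I_sq]
    ring
  have hcont : Continuous fun s : ℝ ↦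
      unitWindow s * Complex.exp (2 * (Complex.I * s) ^ 2 / (1 + Complex.I * b)) := by
    have := unitWindow.continuous
    fun_prop
  have hcomp : HasCompactSupport fun s : ℝ ↦
      unitWindow s * Complex.exp (2 * (Complex.I * s) ^ 2 / (1 + Complex.I * b)) := by
    refine HasCompactSupport.intro (isCompact_Icc (a := (-1 : ℝ)) (b := 1)) fun s hs ↦ ?_
    rw [unitWindow_apply, unitBump_eq_zero hs]
    simp
  have hre : ∀ s : ℝ,
      (unitWindow s * Complex.exp (2 * (Complex.I * s) ^ 2 / (1 + Complex.I * b))).re =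
      unitBump s * (Real.exp (-(2 * s ^ 2) / (1 + b ^ 2)) *
        Real.cos (2 * s ^ 2 * b / (1 + b ^ 2))) := by
    intro s
    rw [unitWindow_apply, Complex.re_ofReal_mul, hexp, Complex.exp_re]
    simp [-Complex.ofReal_div]
  intro h
  have hint : Integrable fun s : ℝ ↦
      unitWindow s * Complex.exp (2 * (Complex.I * s) ^ 2 / (1 + Complex.I * b)) :=
    hcont.integrable_of_hasCompactSupport hcomp
  have hzero := integral_re hint
  rw [h] at hzero
  refine (ne_of_gt ?_) hzero
  refine Continuous.integral_pos_of_hasCompactSupport_nonneg_nonzero (x := 0)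
    (Complex.continuous_re.comp hcont) (hcomp.comp_left Complex.zero_re) (fun s ↦ ?_) ?_
  · change 0 ≤ (unitWindow s * Complex.exp (2 * (Complex.I * s) ^ 2 / (1 + Complex.I * b))).re
    rw [hre]
    by_cases hs : s ∈ Set.Icc (-1 : ℝ) 1
    · have h1 : |2 * s ^ 2 * b / (1 + b ^ 2)| ≤ 1 := by
        rw [abs_div, abs_of_pos hd, div_le_one hd, abs_mul, abs_of_nonneg (by positivity)]
        have hs2 : s ^ 2 ≤ 1 := by rw [sq_le_one_iff_abs_le_one]; exact abs_le.2 hs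
        nlinarith [sq_abs b, abs_nonneg b, sq_nonneg (|b| - 1),
          mul_le_mul_of_nonneg_right hs2 (abs_nonneg b)]
      have hcos : 0 ≤ Real.cos (2 * s ^ 2 * b / (1 + b ^ 2)) := by
        rw [← Real.cos_abs]
        refine Real.cos_nonneg_of_mem_Icc ⟨?_, ?_⟩
        · linarith [abs_nonneg (2 * s ^ 2 * b / (1 + b ^ 2)), Real.pi_pos]
        · linarith [Real.pi_gt_three]
      have := unitBump.nonneg' s
      positivity
    · rw [unitBump_eq_zero hs, zero_mul]
  · change (unitWindow (0 : ℝ) *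
      Complex.exp (2 * (Complex.I * (0 : ℝ)) ^ 2 / (1 + Complex.I * b))).re ≠ 0
    rw [hre, unitBump.one_of_mem_closedBall (by simp [unitBump])]
    simp

theorem integral_windowSymbol_ne_zero (lam : ℝ) (m : ℕ) {b : ℝ} (hb : 0 < b) :
    ∫ s, unitWindow s * windowSymbol lam m (0, b, 0) s ≠ 0 := by
  have hb' : (b : ℂ) ≠ 0 := by exact_mod_cast hb.ne'
  have hb0 : (1 : ℂ) + Complex.I * b ≠ 0 := fun h ↦ by
    have := congrArg Complex.re h
    simp at this
  have h : ∀ s : ℝ, unitWindow s * windowSymbol lam m (0, b, 0) s =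
      ((1 / (Complex.I * b)) ^ ((lam + 1 : ℝ) : ℂ) * (Real.pi / (1 + Complex.I * b)) *
        (Real.pi / (Complex.I * b)) ^ m * Complex.exp (-2)) *
      (unitWindow s * Complex.exp (2 * (Complex.I * s) ^ 2 / (1 + Complex.I * b))) := by
    intro s
    simp only [windowSymbol, windowPoint, Complex.ofReal_zero, Complex.ofReal_one, mul_zero,
      zero_mul, add_zero, zero_add, sub_zero, zero_div, ne_eq, OfNat.ofNat_ne_zero,
      not_false_eq_true, zero_pow, Complex.exp_add]
    ring
  simp_rw [h]
  rw [integral_const_mul]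
  refine mul_ne_zero ?_ integral_unitWindow_mul_cexp_ne_zero
  have hI : Complex.I * b ≠ 0 := mul_ne_zero Complex.I_ne_zero hb'
  have hpi : (Real.pi : ℂ) ≠ 0 := by exact_mod_cast Real.pi_ne_zero
  refine mul_ne_zero (mul_ne_zero (mul_ne_zero ?_ ?_) ?_) (Complex.exp_ne_zero _)
  · rw [Complex.cpow_ne_zero_iff]
    exact Or.inl (one_div_ne_zero hI)
  · exact div_ne_zero hpi hb0
  · exact pow_ne_zero _ (div_ne_zero hpi hI)

/-- Completing squares in the exponent of the heat evolution of the thin Gaussian. -/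
theorem thin_exponent_eq {M b q s : ℝ} (hM : 0 < M) (hb : 0 < b) :
    2 * (((M ^ 2 : ℝ) + Complex.I * (M ^ 2 * b : ℝ)) ^ 2 /
        ((M ^ 2 : ℝ) * windowPoint 1 1 M⁻¹ b s) - (M ^ 2 : ℝ) -
        ((M ^ 2 : ℝ) ^ 2 * b ^ 2 * q : ℝ) / ((M ^ 2 : ℝ) * windowPoint 0 2 M⁻¹ b s)) +
        Complex.I * (M * s * (2 + 2 * q) : ℝ) =
      ((2 * M ^ 2 * b * (1 + q) : ℝ) : ℂ) * Complex.I + (-2 - 4 * q +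
        2 * (Complex.I * s + (M⁻¹ : ℝ)) ^ 2 / windowPoint 1 1 M⁻¹ b s +
        2 * q * (Complex.I * s + 2 * (M⁻¹ : ℝ)) ^ 2 / windowPoint 0 2 M⁻¹ b s) := by
  have hA := windowPoint_ne_zero (ε := M⁻¹) zero_le_one one_pos hb s
  have hB := windowPoint_ne_zero (ε := M⁻¹) le_rfl two_pos hb s
  have hM' : (M : ℂ) ≠ 0 := by exact_mod_cast hM.ne'
  -- With `W` the window point and `d = i s + M⁻¹`, `1 + i b = W - M⁻¹ d`, so `M² (1 + i b)² / W -
  -- M² = M² i b - M d + d² / W`. The transverse part expands likewise; the modulation then cancels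
  -- the terms linear in `M`.
  have eA : Complex.I * b =
      windowPoint 1 1 M⁻¹ b s - 1 - (M : ℂ)⁻¹ * (Complex.I * s + (M : ℂ)⁻¹) := by
    simp only [windowPoint]; push_cast; ring
  have eB : Complex.I * b =
      windowPoint 0 2 M⁻¹ b s - (M : ℂ)⁻¹ * (Complex.I * s + 2 * (M : ℂ)⁻¹) := by
    simp only [windowPoint]; push_cast; ring
  have h1 : (((M ^ 2 : ℝ) : ℂ) + Complex.I * (M ^ 2 * b : ℝ)) ^ 2 /
        ((M ^ 2 : ℝ) * windowPoint 1 1 M⁻¹ b s) - (M ^ 2 : ℝ) =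
      (M : ℂ) ^ 2 * (Complex.I * b) - (M * (Complex.I * s) + 1) +
        (Complex.I * s + (M : ℂ)⁻¹) ^ 2 / windowPoint 1 1 M⁻¹ b s := by
    have : (((M ^ 2 : ℝ) : ℂ) + Complex.I * (M ^ 2 * b : ℝ)) =
        (M : ℂ) ^ 2 * (1 + Complex.I * b) := by push_cast; ring
    rw [this, eA]
    generalize windowPoint 1 1 M⁻¹ b s = W at hA
    push_cast
    field_simp
    ring
  have h2 : ((M ^ 2 : ℝ) ^ 2 * b ^ 2 * q : ℝ) / (((M ^ 2 : ℝ) : ℂ) * windowPoint 0 2 M⁻¹ b s) =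
      -(q * ((M : ℂ) ^ 2 * (Complex.I * b) - (M * (Complex.I * s) + 2) +
        (Complex.I * s + 2 * (M : ℂ)⁻¹) ^ 2 / windowPoint 0 2 M⁻¹ b s)) := by
    have : (((M ^ 2 : ℝ) ^ 2 * b ^ 2 * q : ℝ) : ℂ) =
        -((M : ℂ) ^ 4 * (Complex.I * b) ^ 2 * q) := by
      rw [mul_pow, Complex.I_sq]; push_cast; ring
    rw [this, eB]
    generalize windowPoint 0 2 M⁻¹ b s = W at hB
    push_cast
    field_simp
    ring
  rw [h1, h2]
  push_cast
  ring

theorem cpow_one_half_sq (w : ℂ) : (w ^ (1 / 2 : ℂ)) * (w ^ (1 / 2 : ℂ)) = w := by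
  rw [← sq, ← Complex.cpow_nat_mul]
  norm_num

/-- The Laplace transform of the means of the thin test function along the vertical line
`Re z = 1`, in terms of `windowSymbol`. -/
theorem laplace_brProfile_thinTest {m : ℕ} {lam : ℝ} (hlam : 0 < lam) {M : ℝ} (hM : 0 < M)
    (hN : 1 ≤ M ^ 2) (y : EuclideanSpace ℝ (Fin (m + 1))) (hy : 0 < y 0) {b q : ℝ}
    (hb : b = Real.pi * y 0) (hq : q = (∑ i : Fin m, y i.succ ^ 2) / y 0 ^ 2) (s : ℝ) :
    Complex.exp (Complex.I * (M * s * (2 + 2 * q) : ℝ)) *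
      (∫ r : ℝ, Complex.exp (-(1 + Complex.I * (M ^ 2 * b + M * s : ℝ)) * r) *
        brProfile lam (thinTest m hN) (thinTest m hN) (M ^ 2 • y) r) =
      (((M ^ 2)⁻¹ ^ (lam + 1) * (M ^ 2)⁻¹ ^ (m + 1) : ℝ) : ℂ) * Complex.Gamma (lam + 1) *
        Complex.exp (((2 * M ^ 2 * b * (1 + q) : ℝ) : ℂ) * Complex.I) *
        windowSymbol lam m (M⁻¹, b, q) s := by
  have hb0 : 0 < b := by rw [hb]; positivity
  have hM' : (M : ℂ) ≠ 0 := by exact_mod_cast hM.ne'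
  set z : ℂ := 1 + Complex.I * (M ^ 2 * b + M * s : ℝ) with hz
  have hzre : z.re = 1 := by
    simp only [hz, Complex.add_re, Complex.one_re, Complex.I_mul_re, Complex.ofReal_im, neg_zero,
      add_zero]
  -- Dividing by `M²`, the Gaussian parameter `N` contributes `1`, while `Re z = 1` and the
  -- transverse parameter `1` each contribute `ε²`.
  have z0 : z = (M ^ 2 : ℝ) * windowPoint 0 1 M⁻¹ b s := by
    simp only [hz, windowPoint]; push_cast; field_simp; ring
  have z1 : (M ^ 2 : ℝ) + z = (M ^ 2 : ℝ) * windowPoint 1 1 M⁻¹ b s := by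
    simp only [hz, windowPoint]; push_cast; field_simp; ring
  have z2 : 1 + z = (M ^ 2 : ℝ) * windowPoint 0 2 M⁻¹ b s := by
    simp only [hz, windowPoint]; push_cast; field_simp; ring
  have hB1 := windowPoint_ne_zero (ε := M⁻¹) le_rfl one_pos hb0 s
  have hpow : (1 / z) ^ ((lam : ℂ) + 1) = (((M ^ 2)⁻¹ ^ (lam + 1) : ℝ) : ℂ) *
      (1 / windowPoint 0 1 M⁻¹ b s) ^ ((lam + 1 : ℝ) : ℂ) := by
    rw [← Complex.ofReal_mul_cpow (by positivity) (one_div_ne_zero hB1), z0]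
    push_cast
    congr 1
    field_simp
  have hx0 : Real.pi * Complex.I * ((M ^ 2 • y) 0 : ℝ) = Complex.I * (M ^ 2 * b : ℝ) := by
    rw [hb, PiLp.smul_apply, smul_eq_mul]; push_cast; ring
  have hxs : (Real.pi : ℂ) ^ 2 * ∑ i : Fin m, (((M ^ 2 • y) i.succ : ℝ) : ℂ) ^ 2 =
      ((M ^ 2) ^ 2 * b ^ 2 * q : ℝ) := by
    have : ∑ i : Fin m, y i.succ ^ 2 = q * y 0 ^ 2 := by rw [hq]; field_simp
    have h2 : ∑ i : Fin m, (((M ^ 2 • y) i.succ : ℝ) : ℂ) ^ 2 =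
        (((M ^ 2) ^ 2 * ∑ i : Fin m, y i.succ ^ 2 : ℝ) : ℂ) := by
      push_cast
      rw [Finset.mul_sum]
      refine Finset.sum_congr rfl fun i _ ↦ ?_
      rw [PiLp.smul_apply, smul_eq_mul]; push_cast; ring
    rw [h2, this, hb]
    push_cast
    ring
  rw [integral_brProfile _ _ _ hlam (by rw [hzre]; exact one_pos), fourier_thinTest,
    integral_thinGaussian hN (by rw [hzre]; exact zero_le_one), hpow, hx0, hxs, z1, z2]
  have hexp := thin_exponent_eq (q := q) (s := s) hM hb0
  set e := ((M ^ 2 : ℝ) + Complex.I * (M ^ 2 * b : ℝ)) ^ 2 /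
        ((M ^ 2 : ℝ) * windowPoint 1 1 M⁻¹ b s) - (M ^ 2 : ℝ) -
        ((M ^ 2 : ℝ) ^ 2 * b ^ 2 * q : ℝ) / ((M ^ 2 : ℝ) * windowPoint 0 2 M⁻¹ b s)
  -- Because `f = g`, the complex square roots occur only squared, so no branch has to be tracked.
  set c1 := (Real.pi / ((M ^ 2 : ℝ) * windowPoint 1 1 M⁻¹ b s) : ℂ) ^ (1 / 2 : ℂ) with hc1
  set c2 := (Real.pi / ((M ^ 2 : ℝ) * windowPoint 0 2 M⁻¹ b s) : ℂ) ^ (1 / 2 : ℂ) with hc2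
  have k1 : c1 * c1 = ((M ^ 2)⁻¹ : ℝ) * (Real.pi / windowPoint 1 1 M⁻¹ b s) := by
    rw [hc1, cpow_one_half_sq]; push_cast; field_simp
  have k2 : c2 * c2 = ((M ^ 2)⁻¹ : ℝ) * (Real.pi / windowPoint 0 2 M⁻¹ b s) := by
    rw [hc2, cpow_one_half_sq]; push_cast; field_simp
  have k3 : Complex.exp (Complex.I * (M * s * (2 + 2 * q) : ℝ)) *
      (Complex.exp e * Complex.exp e) =
      Complex.exp (((2 * M ^ 2 * b * (1 + q) : ℝ) : ℂ) * Complex.I) *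
      Complex.exp (-2 - 4 * q +
        2 * (Complex.I * s + (M⁻¹ : ℝ)) ^ 2 / windowPoint 1 1 M⁻¹ b s +
        2 * q * (Complex.I * s + 2 * (M⁻¹ : ℝ)) ^ 2 / windowPoint 0 2 M⁻¹ b s) := by
    rw [← Complex.exp_add (_ * Complex.I), ← hexp, ← Complex.exp_add, ← Complex.exp_add]
    ring_nf
  unfold windowSymbol
  simp only
  set D := Complex.exp (-2 - 4 * q +
        2 * (Complex.I * s + (M⁻¹ : ℝ)) ^ 2 / windowPoint 1 1 M⁻¹ b s +
        2 * q * (Complex.I * s + 2 * (M⁻¹ : ℝ)) ^ 2 / windowPoint 0 2 M⁻¹ b s)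
  set w := (1 / windowPoint 0 1 M⁻¹ b s) ^ ((lam + 1 : ℝ) : ℂ)
  calc _ = (((M ^ 2)⁻¹ ^ (lam + 1) : ℝ) : ℂ) * w * Complex.Gamma (lam + 1) * (c1 * c1) *
        (c2 * c2) ^ m * (Complex.exp (Complex.I * (M * s * (2 + 2 * q) : ℝ)) *
          (Complex.exp e * Complex.exp e)) := by rw [mul_pow]; ring
    _ = _ := by
      rw [k1, k2, k3, mul_pow, Complex.ofReal_mul ((M ^ 2)⁻¹ ^ (lam + 1)),
        Complex.ofReal_pow ((M ^ 2)⁻¹), pow_succ]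
      ring

/-- The base point `(1, 0, …, 0)`. -/
noncomputable def basePoint (m : ℕ) : EuclideanSpace ℝ (Fin (m + 1)) :=
  EuclideanSpace.single 0 1

/-- The integral is continuous in its parameters and nonzero at the limit `M⁻¹ = 0`, `y = basePoint
m`; half of the limiting modulus serves as `c`. -/
theorem exists_integral_windowSymbol_ge (lam : ℝ) (m : ℕ) :
    ∃ c > 0, ∃ δ > 0, ∃ M₀ : ℝ, 1 ≤ M₀ ∧ ∀ M ≥ M₀, ∀ y ∈ Metric.ball (basePoint m) δ,
      0 < y 0 ∧ c ≤ ‖∫ s, unitWindow s * windowSymbol lam m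
        (M⁻¹, Real.pi * y 0, (∑ i : Fin m, y i.succ ^ 2) / y 0 ^ 2) s‖ := by
  let Q : ℝ × EuclideanSpace ℝ (Fin (m + 1)) → ℝ × ℝ × ℝ := fun v ↦
    (v.1, Real.pi * v.2 0, (∑ i : Fin m, v.2 i.succ ^ 2) / v.2 0 ^ 2)
  have hbase : basePoint m 0 = 1 := by simp [basePoint]
  have hQ0 : Q (0, basePoint m) = (0, Real.pi, 0) := by
    simp [Q, basePoint]
  have hQc : ContinuousAt Q (0, basePoint m) := by
    refine ContinuousAt.prodMk (by fun_prop) (ContinuousAt.prodMk (by fun_prop) ?_)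
    exact ContinuousAt.div (by fun_prop) (by fun_prop) (by simp [hbase])
  have hopen : IsOpen {P : ℝ × ℝ × ℝ | 0 < P.2.1} :=
    isOpen_lt continuous_const (by fun_prop)
  have hI : ContinuousAt (fun P ↦ ∫ s, unitWindow s * windowSymbol lam m P s)
      (Q (0, basePoint m)) := by
    refine (continuousOn_integral_windowSymbol lam m).continuousAt (hopen.mem_nhds ?_)
    rw [hQ0]
    exact Real.pi_pos
  have hcomp := (hI.comp hQc).norm
  set L := ‖∫ s, unitWindow s * windowSymbol lam m (0, Real.pi, 0) s‖ with hL
  have hLpos : 0 < L := norm_pos_iff.2 (integral_windowSymbol_ne_zero lam m Real.pi_pos)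
  have hev := hcomp.eventually_const_lt (u := L / 2) (by
    simp only [Function.comp_apply, hQ0]
    rw [← hL]
    linarith)
  have hpos : ∀ᶠ v : ℝ × EuclideanSpace ℝ (Fin (m + 1)) in nhds (0, basePoint m), 0 < v.2 0 := by
    have : ContinuousAt (fun v : ℝ × EuclideanSpace ℝ (Fin (m + 1)) ↦ v.2 0) (0, basePoint m) := by
      fun_prop
    exact this.eventually_const_lt (by simp [hbase])
  obtain ⟨δ, hδ, hball⟩ := Metric.eventually_nhds_iff_ball.1 (hev.and hpos)
  refine ⟨L / 2, by positivity, δ, hδ, max 1 (2 / δ), le_max_left _ _, fun M hM y hy ↦ ?_⟩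
  have hM1 : 2 / δ ≤ M := (le_max_right _ _).trans hM
  have hM0 : 0 < M := lt_of_lt_of_le one_pos ((le_max_left _ _).trans hM)
  have hmem : (M⁻¹, y) ∈ Metric.ball ((0 : ℝ), basePoint m) δ := by
    rw [← ball_prod_same]
    refine ⟨?_, hy⟩
    rw [mem_ball_zero_iff, Real.norm_of_nonneg (by positivity), inv_lt_comm₀ hM0 hδ]
    calc δ⁻¹ < 2 / δ := by rw [inv_eq_one_div]; gcongr; norm_num
      _ ≤ M := hM1
  obtain ⟨h1, h2⟩ := hball _ hmem
  exact ⟨h2, h1.le⟩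

/-- The maximal function of the thin test function is large on a ball of radius comparable to
`N = M²`. -/
theorem exists_maximalBR_thinTest_ge (m : ℕ) {lam : ℝ} (hlam : 0 < lam) :
    ∃ c > 0, ∃ δ > 0, ∃ M₀ : ℝ, 1 ≤ M₀ ∧ ∀ M ≥ M₀, ∀ hN : 1 ≤ M ^ 2,
      ∀ y ∈ Metric.ball (basePoint m) δ,
      ENNReal.ofReal (c * M ^ (-(2 * lam + 2 * m + 3))) ≤
        maximalBR lam (thinTest m hN) (thinTest m hN) (M ^ 2 • y) := by
  obtain ⟨c, hc, δ, hδ, M₀, hM₀, h⟩ := exists_integral_windowSymbol_ge lam m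
  obtain ⟨K, hK, hwin⟩ := exists_norm_window_laplace_le hlam unitWindow
  have hΓ : 0 < Real.Gamma (lam + 1) := Real.Gamma_pos_of_pos (by linarith)
  refine ⟨c * Real.Gamma (lam + 1) / K, by positivity, δ, hδ, M₀, hM₀, fun M hM hN y hy ↦ ?_⟩
  have hM0 : 0 < M := by linarith
  obtain ⟨hy0, hlow⟩ := h M hM y hy
  set T := maximalBR lam (thinTest m hN) (thinTest m hN) (M ^ 2 • y) with hT
  rcases eq_or_ne T ∞ with hinf | hfin
  · rw [hinf]; exact le_top
  have hS : ∀ t : ℝ, 0 < t →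
      ‖bilinearBR lam t (thinTest m hN) (thinTest m hN) (M ^ 2 • y)‖ ≤ T.toReal := by
    intro t ht
    have : ‖bilinearBR lam t (thinTest m hN) (thinTest m hN) (M ^ 2 • y)‖ₑ ≤ T :=
      le_iSup₂_of_le t ht le_rfl
    rw [← toReal_enorm]
    exact ENNReal.toReal_mono hfin this
  rw [ENNReal.ofReal_le_iff_le_toReal hfin]
  set b := Real.pi * y 0 with hb
  set q := (∑ i : Fin m, y i.succ ^ 2) / y 0 ^ 2 with hq
  -- At `x = M² y` and time `M² b = M² π y₀`, the phase `2π x·ξ - M² b |ξ|²` is stationary at `ξ = y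
  -- / y₀`. There `|ξ|² = 1 + q`, so the total energy of the pair is `r₀ = 2 + 2 q`.
  have hb1 := hwin (brProfile lam (thinTest m hN) (thinTest m hN) (M ^ 2 • y)) T.toReal M
    (M ^ 2 * b) (2 + 2 * q) hM0 (norm_brProfile_le _ _ _ hlam hS)
    (integrable_brProfile _ _ _ hlam (by simp))
  have heq : ∀ s : ℝ, unitWindow s * Complex.exp (Complex.I * (M * s * (2 + 2 * q) : ℝ)) *
      (∫ r : ℝ, Complex.exp (-(1 + Complex.I * (M ^ 2 * b + M * s : ℝ)) * r) *
        brProfile lam (thinTest m hN) (thinTest m hN) (M ^ 2 • y) r) =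
      ((((M ^ 2)⁻¹ ^ (lam + 1) * (M ^ 2)⁻¹ ^ (m + 1) : ℝ) : ℂ) * Complex.Gamma (lam + 1) *
        Complex.exp (((2 * M ^ 2 * b * (1 + q) : ℝ) : ℂ) * Complex.I)) *
        (unitWindow s * windowSymbol lam m (M⁻¹, b, q) s) := by
    intro s
    rw [mul_assoc, laplace_brProfile_thinTest hlam hM0 hN y hy0 hb hq]
    ring
  simp_rw [heq] at hb1
  have hΓ' : Complex.Gamma (lam + 1) = ((Real.Gamma (lam + 1) : ℝ) : ℂ) := by
    rw [← Complex.Gamma_ofReal]; push_cast; rfl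
  rw [integral_const_mul, norm_mul, norm_mul, norm_mul, Complex.norm_exp_ofReal_mul_I, mul_one,
    hΓ', Complex.norm_real, Complex.norm_real, Real.norm_of_nonneg (by positivity),
    Real.norm_of_nonneg hΓ.le, le_div_iff₀ hM0] at hb1
  -- The extra factor `M` is the gain from the window.
  have hpow : (M ^ 2)⁻¹ ^ (lam + 1) * (M ^ 2)⁻¹ ^ (m + 1) * M = M ^ (-(2 * lam + 2 * m + 3)) := by
    rw [← Real.rpow_natCast (M ^ 2)⁻¹ (m + 1), ← Real.rpow_natCast M 2, ← Real.rpow_neg hM0.le,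
      ← Real.rpow_mul hM0.le, ← Real.rpow_mul hM0.le, ← Real.rpow_add hM0]
    nth_rewrite 2 [← Real.rpow_one M]
    rw [← Real.rpow_add hM0]
    congr 1
    push_cast
    ring
  have hfin2 : M ^ (-(2 * lam + 2 * m + 3)) * Real.Gamma (lam + 1) * c ≤ K * T.toReal := by
    refine le_trans ?_ hb1
    rw [← hpow]
    calc _ = (M ^ 2)⁻¹ ^ (lam + 1) * (M ^ 2)⁻¹ ^ (m + 1) * Real.Gamma (lam + 1) * c * M := by ring
      _ ≤ _ := by gcongr
  calc _ = (M ^ (-(2 * lam + 2 * m + 3)) * Real.Gamma (lam + 1) * c) / K := by ring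
    _ ≤ _ := by rw [div_le_iff₀ hK]; linarith

/-! ### Dilations -/

section Dilation

variable {n : ℕ}

/-- The dilate `y ↦ f (δ y)` of a Schwartz function. -/
noncomputable def schwartzDilate {δ : ℝ} (hδ : δ ≠ 0) (f : 𝓢(EuclideanSpace ℝ (Fin n), ℂ)) :
    𝓢(EuclideanSpace ℝ (Fin n), ℂ) :=
  SchwartzMap.compCLMOfContinuousLinearEquiv ℂ
    (ContinuousLinearEquiv.smulLeft (Units.mk0 δ hδ)) f

theorem schwartzDilate_apply {δ : ℝ} (hδ : δ ≠ 0) (f : 𝓢(EuclideanSpace ℝ (Fin n), ℂ))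
    (y : EuclideanSpace ℝ (Fin n)) : schwartzDilate hδ f y = f (δ • y) := rfl

theorem fourier_schwartzDilate {δ : ℝ} (hδ : 0 < δ) (f : 𝓢(EuclideanSpace ℝ (Fin n), ℂ))
    (ξ : EuclideanSpace ℝ (Fin n)) :
    𝓕 (schwartzDilate hδ.ne' f : EuclideanSpace ℝ (Fin n) → ℂ) ξ =
      (((δ ^ n)⁻¹ : ℝ) : ℂ) * 𝓕 (f : EuclideanSpace ℝ (Fin n) → ℂ) (δ⁻¹ • ξ) := by
  have h := Measure.integral_comp_smul (volume : Measure (EuclideanSpace ℝ (Fin n)))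
    (fun v ↦ Complex.exp (((-2 * Real.pi * inner ℝ v (δ⁻¹ • ξ) : ℝ) : ℂ) * Complex.I) • f v) δ
  rw [Real.fourier_eq', Real.fourier_eq', ← Complex.real_smul]
  rw [finrank_euclideanSpace_fin, abs_of_pos (by positivity)] at h
  rw [← h]
  refine integral_congr_ae (ae_of_all _ fun v ↦ ?_)
  simp only [schwartzDilate_apply, real_inner_smul_left, real_inner_smul_right]
  congr 4
  field_simp

theorem bilinearBR_schwartzDilate (lam t : ℝ) {δ : ℝ} (hδ : 0 < δ)
    (f g : 𝓢(EuclideanSpace ℝ (Fin n), ℂ)) (x : EuclideanSpace ℝ (Fin n)) :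
    bilinearBR lam t (schwartzDilate hδ.ne' f) (schwartzDilate hδ.ne' g) x =
      bilinearBR lam (δ * t) f g (δ • x) := by
  let h : EuclideanSpace ℝ (Fin n) → EuclideanSpace ℝ (Fin n) → ℂ := fun ξ η ↦
    (brMultiplier lam ((δ * t) • ξ) ((δ * t) • η) : ℂ) *
      𝓕 (f : EuclideanSpace ℝ (Fin n) → ℂ) ξ * 𝓕 (g : EuclideanSpace ℝ (Fin n) → ℂ) η *
      Complex.exp (2 * Real.pi * Complex.I * (inner ℝ (δ • x) (ξ + η) : ℝ))
  have hpt : ∀ ξ η, (brMultiplier lam (t • ξ) (t • η) : ℂ) *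
      𝓕 (schwartzDilate hδ.ne' f : EuclideanSpace ℝ (Fin n) → ℂ) ξ *
      𝓕 (schwartzDilate hδ.ne' g : EuclideanSpace ℝ (Fin n) → ℂ) η *
      Complex.exp (2 * Real.pi * Complex.I * (inner ℝ x (ξ + η) : ℝ)) =
      (((δ ^ n)⁻¹ : ℝ) : ℂ) * ((((δ ^ n)⁻¹ : ℝ) : ℂ) * h (δ⁻¹ • ξ) (δ⁻¹ • η)) := by
    intro ξ η
    have e1 (v : EuclideanSpace ℝ (Fin n)) : (δ * t) • δ⁻¹ • v = t • v := by
      rw [smul_smul]; congr 1; field_simp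
    have e2 : inner ℝ (δ • x) (δ⁻¹ • ξ + δ⁻¹ • η) = inner ℝ x (ξ + η) := by
      rw [← smul_add, real_inner_smul_left, real_inner_smul_right]; field_simp
    simp only [h, e1, e2, fourier_schwartzDilate hδ]
    ring
  have hδn : ((δ ^ n : ℝ) : ℂ) ≠ 0 := by exact_mod_cast (pow_pos hδ n).ne'
  have hcomp (k : EuclideanSpace ℝ (Fin n) → ℂ) :
      (((δ ^ n)⁻¹ : ℝ) : ℂ) * ∫ v, k (δ⁻¹ • v) = ∫ v, k v := by
    rw [Measure.integral_comp_inv_smul_of_nonneg _ k hδ.le, finrank_euclideanSpace_fin,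
      Complex.real_smul, Complex.ofReal_inv, inv_mul_cancel_left₀ hδn]
  change _ = ∫ ξ, ∫ η, h ξ η
  rw [bilinearBR, ← hcomp fun ξ ↦ ∫ η, h ξ η, ← integral_const_mul]
  refine integral_congr_ae (ae_of_all _ fun ξ ↦ ?_)
  simp only
  rw [← hcomp (h (δ⁻¹ • ξ)), ← integral_const_mul, ← integral_const_mul]
  exact integral_congr_ae (ae_of_all _ (hpt ξ))

theorem maximalBR_le_schwartzDilate (lam : ℝ) {δ : ℝ} (hδ : 0 < δ)
    (f g : 𝓢(EuclideanSpace ℝ (Fin n), ℂ)) (x : EuclideanSpace ℝ (Fin n)) :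
    maximalBR lam f g (δ • x) ≤
      maximalBR lam (schwartzDilate hδ.ne' f) (schwartzDilate hδ.ne' g) x := by
  refine iSup₂_le fun t ht ↦ le_iSup₂_of_le (δ⁻¹ * t) (by positivity) ?_
  rw [bilinearBR_schwartzDilate _ _ hδ, mul_inv_cancel_left₀ hδ.ne']

theorem eLpNorm_schwartzDilate {δ : ℝ} (hδ : 0 < δ) (f : 𝓢(EuclideanSpace ℝ (Fin n), ℂ))
    (p : ℝ≥0∞) : eLpNorm (schwartzDilate hδ.ne' f) p volume =
      ENNReal.ofReal (δ ^ (-(n * (1 / p).toReal))) * eLpNorm f p volume := by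
  have hd : 0 < (δ ^ n)⁻¹ := by positivity
  have : (schwartzDilate hδ.ne' f : EuclideanSpace ℝ (Fin n) → ℂ) = f ∘ (δ • ·) := rfl
  rw [this, ← eLpNorm_map_measure f.continuous.aestronglyMeasurable
      (measurable_const_smul δ).aemeasurable, Measure.map_addHaar_smul _ hδ.ne',
    finrank_euclideanSpace_fin, abs_of_pos hd,
    eLpNorm_smul_measure_of_ne_zero (by simpa using hd), smul_eq_mul, ENNReal.ofReal_rpow_of_pos hd]
  congr 2
  rw [← Real.rpow_natCast, ← Real.rpow_neg hδ.le, ← Real.rpow_mul hδ.le]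
  congr 1
  ring

end Dilation

/-! ### The necessary condition -/

theorem nonneg_of_forall_le_mul_rpow {c C e R₀ : ℝ} (hc : 0 < c)
    (h : ∀ R ≥ R₀, 1 ≤ R → c ≤ C * R ^ e) : 0 ≤ e := by
  by_contra! he
  have ht : Filter.Tendsto (fun R : ℝ ↦ C * R ^ e) Filter.atTop (nhds (C * 0)) := by
    have := tendsto_rpow_neg_atTop (y := -e) (by linarith)
    rw [neg_neg] at this
    exact this.const_mul C
  have : c ≤ C * 0 := ge_of_tendsto ht (by
    filter_upwards [Filter.eventually_ge_atTop R₀, Filter.eventually_ge_atTop 1] with R h1 h2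
    exact h R h1 h2)
  linarith

/-- Testing the weak type inequality on dilates of the thin test functions. -/
theorem exists_rpow_le_of_maximalBRWeakBounded {m : ℕ} {lam : ℝ} (hlam : 0 < lam)
    {p₁ p₂ p : ℝ≥0∞} (hpt : p ≠ ∞) (hT : MaximalBRWeakBounded (m + 1) lam p₁ p₂ p) :
    ∃ c > 0, ∃ D M₀ : ℝ, 1 ≤ M₀ ∧ ∀ M ≥ M₀, ∀ δ > 0,
      c * (M ^ (-(2 * lam + 2 * m + 3)) * (M ^ 2 / δ) ^ ((m + 1) * (1 / p).toReal)) ≤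
        D * (M ^ ((1 / p₁).toReal + (1 / p₂).toReal - 2) *
          δ ^ (-((m + 1) * ((1 / p₁).toReal + (1 / p₂).toReal)))) := by
  obtain ⟨C, hC⟩ := hT
  obtain ⟨c, hc, r, hr, M₀, hM₀, hlow⟩ := exists_maximalBR_thinTest_ge m hlam
  set U := Metric.ball (basePoint m) r
  have hUtop : volume U ≠ ∞ := measure_ball_lt_top.ne
  have hUpos : 0 < (volume U).toReal :=
    ENNReal.toReal_pos (Metric.measure_ball_pos _ _ hr).ne' hUtop
  set V := (volume U).toReal with hV
  set E₁ := (eLpNorm (thinTest m le_rfl) p₁ volume).toReal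
  set E₂ := (eLpNorm (thinTest m le_rfl) p₂ volume).toReal
  set P := (1 / p).toReal with hP
  have hPr : 1 / p.toReal = P := by rw [hP, ENNReal.toReal_div, ENNReal.toReal_one]
  refine ⟨c / 2 * V ^ P, by positivity, C * E₁ * E₂, M₀, hM₀, fun M hM δ hδ ↦ ?_⟩
  have hM0 : 0 < M := by linarith
  have hN : 1 ≤ M ^ 2 := one_le_pow₀ (hM₀.trans hM)
  -- Halving the lower bound gives the strict inequality in the level set.
  set a := c / 2 * M ^ (-(2 * lam + 2 * m + 3)) with ha
  have ha0 : 0 < a := by positivity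
  set f := schwartzDilate hδ.ne' (thinTest m hN)
  have hsub : ((δ / M ^ 2) • · : EuclideanSpace ℝ (Fin (m + 1)) → _) ⁻¹' U ⊆
      {x | ((a.toNNReal : ℝ≥0) : ℝ≥0∞) < maximalBR lam f f x} := by
    intro x hx
    have h1 := hlow M hM hN _ hx
    have h2 : M ^ 2 • (δ / M ^ 2) • x = δ • x := by
      rw [smul_smul]; congr 1; field_simp
    simp only [h2] at h1
    refine lt_of_lt_of_le ?_ (h1.trans (maximalBR_le_schwartzDilate lam hδ _ _ x))
    refine ENNReal.ofReal_lt_ofReal_iff'.2 ⟨?_, by positivity⟩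
    rw [ha]
    gcongr
    linarith
  have hvol : ENNReal.ofReal ((M ^ 2 / δ) ^ (m + 1) * V) ≤
      volume {x | ((a.toNNReal : ℝ≥0) : ℝ≥0∞) < maximalBR lam f f x} := by
    refine le_trans (le_of_eq ?_) (measure_mono hsub)
    rw [Measure.addHaar_preimage_smul _ (by positivity), finrank_euclideanSpace_fin,
      abs_of_pos (by positivity), ENNReal.ofReal_mul (by positivity), hV,
      ENNReal.ofReal_toReal hUtop, ← inv_pow, inv_div]
  have hlower : ENNReal.ofReal (a * ((M ^ 2 / δ) ^ (m + 1) * V) ^ P) ≤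
      weakLpNorm (maximalBR lam f f) p volume := by
    rw [weakLpNorm, if_neg hpt, hPr]
    refine le_iSup_of_le a.toNNReal ?_
    rw [ENNReal.ofReal_mul ha0.le, ← ENNReal.ofReal_rpow_of_pos (by positivity)]
    exact mul_le_mul' le_rfl (ENNReal.rpow_le_rpow hvol ENNReal.toReal_nonneg)
  have hnorm (p' : ℝ≥0∞) : eLpNorm f p' volume =
      ENNReal.ofReal (δ ^ (-((m + 1) * (1 / p').toReal)) * M ^ ((1 / p').toReal - 1) *
        (eLpNorm (thinTest m le_rfl) p' volume).toReal) := by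
    rw [eLpNorm_schwartzDilate hδ, eLpNorm_thinTest hM0, ENNReal.ofReal_mul (by positivity),
      ENNReal.ofReal_mul (by positivity),
      ENNReal.ofReal_toReal (SchwartzMap.eLpNorm_lt_top (thinTest m le_rfl) p' volume).ne,
      mul_assoc]
    push_cast
    rfl
  have hmain := hlower.trans (hC f f)
  rw [hnorm, hnorm, ← ENNReal.ofReal_coe_nnreal, ← ENNReal.ofReal_mul (by positivity),
    ← ENNReal.ofReal_mul (by positivity), ENNReal.ofReal_le_ofReal_iff (by positivity)] at hmain
  have e1 : ((M ^ 2 / δ) ^ (m + 1) * V) ^ P = (M ^ 2 / δ) ^ ((m + 1) * P) * V ^ P := by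
    rw [Real.mul_rpow (by positivity) hUpos.le, ← Real.rpow_natCast,
      ← Real.rpow_mul (by positivity)]
    push_cast
    rfl
  have e2 : δ ^ (-((m + 1) * ((1 / p₁).toReal + (1 / p₂).toReal))) =
      δ ^ (-((m + 1) * (1 / p₁).toReal)) * δ ^ (-((m + 1) * (1 / p₂).toReal)) := by
    rw [← Real.rpow_add hδ]; ring_nf
  have e3 : M ^ ((1 / p₁).toReal + (1 / p₂).toReal - 2) =
      M ^ ((1 / p₁).toReal - 1) * M ^ ((1 / p₂).toReal - 1) := by
    rw [← Real.rpow_add hM0]; ring_nf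
  rw [e1] at hmain
  rw [e2, e3]
  calc _ = a * ((M ^ 2 / δ) ^ ((m + 1) * P) * V ^ P) := by rw [ha]; ring
    _ ≤ _ := hmain
    _ = _ := by ring

/-- With `M = M₀` frozen, the two sides differ by a power of `δ`; letting `δ → ∞` and `δ → 0` forces
its exponent to vanish. -/
theorem inv_eq_add_of_maximalBRWeakBounded {m : ℕ} {lam : ℝ} (hlam : 0 < lam)
    {p₁ p₂ p : ℝ≥0∞} (hpt : p ≠ ∞) (hT : MaximalBRWeakBounded (m + 1) lam p₁ p₂ p) :
    (1 / p).toReal = (1 / p₁).toReal + (1 / p₂).toReal := by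
  obtain ⟨c, hc, D, M₀, hM₀, h⟩ := exists_rpow_le_of_maximalBRWeakBounded hlam hpt hT
  set P := (1 / p).toReal
  set Q := (1 / p₁).toReal + (1 / p₂).toReal
  have hM0 : 0 < M₀ := by linarith
  set c' := c * (M₀ ^ (-(2 * lam + 2 * m + 3)) * (M₀ ^ 2) ^ ((m + 1) * P)) with hc'
  have hc'0 : 0 < c' := by positivity
  have key : ∀ δ > 0, c' ≤ D * M₀ ^ (Q - 2) * δ ^ ((m + 1) * (P - Q)) := by
    intro δ hδ
    have h1 := h M₀ le_rfl δ hδ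
    rw [Real.div_rpow (by positivity) hδ.le] at h1
    have e : δ ^ ((m + 1) * (P - Q)) = δ ^ ((m + 1) * P) * δ ^ (-((m + 1) * Q)) := by
      rw [← Real.rpow_add hδ]; ring_nf
    have h2 := mul_le_mul_of_nonneg_right h1 (Real.rpow_nonneg hδ.le ((m + 1) * P))
    rw [e]
    calc c' = c * (M₀ ^ (-(2 * lam + 2 * m + 3)) *
          ((M₀ ^ 2) ^ ((m + 1) * P) / δ ^ ((m + 1) * P))) * δ ^ ((m + 1) * P) := by
          rw [hc']; field_simp
      _ ≤ _ := h2
      _ = _ := by ring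
  have h1 : 0 ≤ (m + 1) * (P - Q) :=
    nonneg_of_forall_le_mul_rpow (R₀ := 1) hc'0 fun R _ hR ↦ key R (by linarith)
  have h2 : 0 ≤ -((m + 1) * (P - Q)) := by
    refine nonneg_of_forall_le_mul_rpow (R₀ := 1) (C := D * M₀ ^ (Q - 2)) hc'0 fun R _ hR ↦ ?_
    have := key R⁻¹ (by positivity)
    rwa [Real.inv_rpow (by positivity), ← Real.rpow_neg (by positivity)] at this
  have h3 : (m + 1) * (P - Q) = 0 := le_antisymm (by linarith) h1
  rcases mul_eq_zero.1 h3 with h4 | h4 <;> linarith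

theorem proposition06152 (n : ℕ) (hn : 1 ≤ n) (lam : ℝ) (hlam : 0 < lam)
    (p₁ p₂ p : ℝ≥0∞) (hp₁ : 0 < p₁) (hp₂ : 0 < p₂) (hp : 0 < p)
    (hT : MaximalBRWeakBounded n lam p₁ p₂ p) :
    (2 * (n : ℝ) - 1) / 2 * (1 / p).toReal - (2 * (n : ℝ) - 1) / 2 ≤ lam := by
  obtain ⟨m, rfl⟩ : ∃ m, n = m + 1 := ⟨n - 1, by omega⟩
  have hm : (0 : ℝ) ≤ m := by positivity
  -- For `p = ∞` the lower bound on `lam` is negative, so `lam > 0` suffices.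
  rcases eq_or_ne p ∞ with rfl | hpt
  · simp only [ENNReal.div_top, ENNReal.toReal_zero, mul_zero]
    push_cast
    linarith
  have hPQ := inv_eq_add_of_maximalBRWeakBounded hlam hpt hT
  obtain ⟨c, hc, D, M₀, hM₀, h⟩ := exists_rpow_le_of_maximalBRWeakBounded hlam hpt hT
  rw [← hPQ] at h
  set P := (1 / p).toReal
  -- Here `δ = 1` and `M → ∞`. The inequality reads `2 lam ≥ (2 m + 1)(P - 1)`, and `2 m + 1 = 2 n -
  -- 1`.
  have hfin : 0 ≤ (P - 2) + (2 * lam + 2 * m + 3) - 2 * ((m + 1) * P) := by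
    refine nonneg_of_forall_le_mul_rpow (R₀ := M₀) (C := D) hc fun M hM hM1 ↦ ?_
    have hM0 : 0 < M := by linarith
    have h1 := h M hM 1 one_pos
    rw [div_one, Real.one_rpow, mul_one, ← Real.rpow_natCast M 2, ← Real.rpow_mul hM0.le,
      ← Real.rpow_add hM0] at h1
    have h2 := mul_le_mul_of_nonneg_right h1
      (Real.rpow_nonneg hM0.le ((2 * lam + 2 * m + 3) - 2 * ((m + 1) * P)))
    rw [mul_assoc, mul_assoc, ← Real.rpow_add hM0, ← Real.rpow_add hM0] at h2
    push_cast at h2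
    have e1 : -(2 * lam + 2 * m + 3) + 2 * ((m + 1) * P) +
        (2 * lam + 2 * m + 3 - 2 * ((m + 1) * P)) = 0 := by ring
    rwa [e1, Real.rpow_zero, mul_one, ← add_sub_assoc] at h2
  push_cast
  linarith
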